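/- Let $R$ be a commutative ring with unit and let $L$ be an oriented link represented by an oriented link diagram $D$ in the plane, with $p$ positive and $n$ negative crossings, $w=p-n$, and with the crossings ordered. (Diagrams are taken up to the usual combinatorial encoding: an oriented 4-valent map with over/under information, all of whose connected components have genus zero, together with finitely many circles without crossings.) A state $s$ labels each crossing $A$ or $B$; $a(s)$ and $b(s)$ are the numbers of $A$- and $B$-labels, and $sD$ is the collection of circles obtained by smoothing every crossing according to its label (the $A$-smoothing joins the two regions swept by the over-strand when it is turned counterclockwise, the $B$-smoothing joins the other two), together with, for each crossing, a chord joining the two arcs of its smoothing. An enhanced state is a state $s$ with a sign $\pm1$ on each circle of $sD$; $\tau(s)$ is the sum of the signs, and $$i(s)=\frac{w-(a(s)-b(s))}{2},\qquad j(s)=w+i(s)+\tau(s).$$ An enhanced state $t$ is adjacent to $s$ if $i(t)=i(s)+1$ and $j(t)=j(s)$, the labels of $t$ are those of $s$ except at one crossing $x$, labelled $A$ by $s$ and $B$ by $t$, and $s$ and $t$ give the same signs to the common circles of $sD$ and $tD$. Let $C^{i,j}(D)$ be the free $R$-module on the enhanced states $s$ with $i(s)=i$, $j(s)=j$, and let $d_i:C^{i,j}(D)\to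 C^{i+1,j}(D)$, $d_i(s)=\sum_t (s:t)\,t$, where $(s:t)=(-1)^k$ if $t$ is adjacent to $s$, with $k$ the number of $B$-labelled crossings after $x$, and $(s:t)=0$ otherwise. The Khovanov cohomology of $L$ is $H^{i,j}(L)=H^{i,j}(D)=\ker d_i/\operatorname{im} d_{i-1}$. Let $j_{\min}(D)$ be the smallest value of $j(s)$ over all enhanced states $s$ of $D$. Let $s_A$ be the state with all labels $A$. The Lando graph $G_D$ has a vertex for every chord of $s_AD$ with both ends on the same circle, and an edge joining two vertices if the ends of the corresponding chords alternate in the same circle. **Corollary.** With $j=j_{\min}(D)$, $$H^{1-n,\,j}(L)\cong R$$ as $R$-modules if $G_D$ is a complete bipartite graph $K_{r,s}$ for some $r,s\ge 1$, and $H^{1-n,\,j}(L)=0$ otherwise. -/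

import Mathlib

/-- The involution `i ↔ j` of the four half-edges at a crossing that a smoothing creates.
The half-edges at a crossing are numbered `0, 1, 2, 3` counterclockwise, `0` being the incoming
half-edge of the under-strand (so `2` is the outgoing one, and `1, 3` form the over-strand).
Turning the over-strand counterclockwise sweeps the regions between `1, 2` and between `3, 0`.
The `A`-smoothing (`b = false`) joins these two regions, so that its two arcs are `{0, 1}` and
`{2, 3}`; the `B`-smoothing (`b = true`) has the arcs `{0, 3}` and `{1, 2}`. -/
def smoothPartner (b : Bool) (k : Fin 4) : Fin 4 :=
  if b then ![3, 2, 1, 0] k else ![1, 0, 3, 2] k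

/-- Is the half-edge number `k` at a crossing directed away from the crossing?
At a positive crossing the over-strand runs from `3` to `1`, at a negative one from `1` to `3`. -/
def isOutgoing (positive : Bool) (k : Fin 4) : Bool :=
  ![false, positive, true, !positive] k

/-- The next half-edge, counterclockwise, at the same crossing. -/
def rotateDart {X : Type*} (d : X × Fin 4) : X × Fin 4 := (d.1, d.2 + 1)

/-- Oriented link diagrams with set of crossings `X`, as oriented planar diagrams (PD codes):
a 4-valent map on the sphere, with over/under information and orientation, together
with a number of simple closed curves that run through no crossing.
The pair `(x, k)` is the half-edge number `k` at the crossing `x`. -/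
structure OrientedLinkDiagram (X : Type*) [Fintype X] where
  /-- whether a crossing is positive -/
  positive : X → Bool
  /-- the other half of the edge to which a half-edge belongs -/
  glue : X × Fin 4 → X × Fin 4
  glue_glue : ∀ d, glue (glue d) = d
  /-- every edge is directed from one of its halves to the other one -/
  oriented : ∀ d, isOutgoing (positive (glue d).1) (glue d).2 = !isOutgoing (positive d.1) d.2
  /-- Every connected component of the map has genus zero: the number of faces is
  `E - V + 2 κ`, with `V = c` vertices, `E = 2 c` edges and `κ` connected components. -/
  planar : Nat.card (Quot fun d d' : X × Fin 4 => d' = rotateDart (glue d)) =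
    Fintype.card X +
      2 * Nat.card (Quot fun d d' : X × Fin 4 => d' = rotateDart d ∨ d' = glue d)
  /-- the number of components of the diagram without crossings -/
  freeCircles : ℕ

/-- The cohomology `ker g / im f` of a complex of modules `M → N → P`. -/
abbrev CohomologyAt {R M N P : Type*} [CommRing R] [AddCommGroup M] [AddCommGroup N]
    [AddCommGroup P] [Module R M] [Module R N] [Module R P] (f : M →ₗ[R] N) (g : N →ₗ[R] P) :
    Type _ :=
  LinearMap.ker g ⧸ (LinearMap.range f).submoduleOf (LinearMap.ker g)

namespace OrientedLinkDiagram

section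

variable {X : Type*} [Fintype X] [LinearOrder X] (D : OrientedLinkDiagram X)

/-- The number of positive crossings. -/
def numPos : ℕ := (Finset.univ.filter fun x => D.positive x = true).card

/-- The number of negative crossings. -/
def numNeg : ℕ := (Finset.univ.filter fun x => D.positive x = false).card

/-- The writhe. -/
def writhe : ℤ := (D.numPos : ℤ) - D.numNeg

/-- The half-edge joined to `d` at its crossing when the crossings in `s` are `B`-smoothed
and all the others are `A`-smoothed. -/
def smooth (s : Finset X) (d : X × Fin 4) : X × Fin 4 :=
  (d.1, smoothPartner (decide (d.1 ∈ s)) d.2)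

/-- The circles of the smoothed diagram `sD` that contain half-edges. A state `s` is given by
the set of the crossings that it labels `B`. -/
def DartCircle (s : Finset X) : Type _ :=
  Quot fun d d' : X × Fin 4 => d' = D.glue d ∨ d' = smooth s d

/-- The circle of `sD` that contains a given half-edge. -/
def circleOf (s : Finset X) (d : X × Fin 4) : D.DartCircle s := Quot.mk _ d

/-- All circles of the smoothed diagram `sD`. -/
def Circle (s : Finset X) : Type _ := D.DartCircle s ⊕ Fin D.freeCircles

instance finite_dartCircle (s : Finset X) : Finite (D.DartCircle s) :=
  Finite.of_surjective (D.circleOf s) Quot.mk_surjective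

instance finite_circle (s : Finset X) : Finite (D.Circle s) :=
  inferInstanceAs (Finite (D.DartCircle s ⊕ Fin D.freeCircles))

noncomputable instance fintypeCircle (s : Finset X) : Fintype (D.Circle s) :=
  Fintype.ofFinite _

/-- Enhanced states: a state `s` (the set of crossings labelled `B`), and a sign for every
circle of `sD`. -/
structure EnhancedState where
  state : Finset X
  sign : D.Circle state → ℤˣ

instance finite_enhancedState : Finite D.EnhancedState :=
  Finite.of_injective
    (fun e : D.EnhancedState => (⟨e.state, e.sign⟩ : Σ s : Finset X, (D.Circle s → ℤˣ)))
    (by rintro ⟨s, e⟩ ⟨t, f⟩ h; cases h; rfl)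

instance nonempty_enhancedState : Nonempty D.EnhancedState := ⟨⟨∅, fun _ => 1⟩⟩

noncomputable instance fintypeEnhancedState : Fintype D.EnhancedState := Fintype.ofFinite _

namespace EnhancedState

variable {D}

/-- `σ(s)`, the number of `A`-labels minus the number of `B`-labels. -/
def sigma (s : D.EnhancedState) : ℤ := ((s.stateᶜ).card : ℤ) - s.state.card

/-- `τ(s)`, the sum of the signs of all circles. -/
noncomputable def tau (s : D.EnhancedState) : ℤ := ∑ c : D.Circle s.state, (s.sign c : ℤ)

/-- The degree `i(s) = (w - σ(s)) / 2`; the numerator is always even. -/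
def iDeg (s : D.EnhancedState) : ℤ := (D.writhe - s.sigma) / 2

/-- The degree `j(s) = w + i(s) + τ(s)`. -/
noncomputable def jDeg (s : D.EnhancedState) : ℤ := D.writhe + s.iDeg + s.tau

/-- `t` is adjacent to `s`, with change crossing `x`. A circle of `sD` is also
a circle of `tD` if it consists of the same half-edges, or is one of the free circles. -/
def AdjacentAt (s t : D.EnhancedState) (x : X) : Prop :=
  (t.iDeg = s.iDeg + 1 ∧ t.jDeg = s.jDeg) ∧
  (x ∉ s.state ∧ t.state = insert x s.state) ∧
  (∀ d : X × Fin 4,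
    (∀ d', D.circleOf s.state d' = D.circleOf s.state d ↔
      D.circleOf t.state d' = D.circleOf t.state d) →
    s.sign (Sum.inl (D.circleOf s.state d)) = t.sign (Sum.inl (D.circleOf t.state d))) ∧
  (∀ k : Fin D.freeCircles, s.sign (Sum.inr k) = t.sign (Sum.inr k))

open Classical in
/-- The incidence number `(s : t)`: it is `(-1) ^ k` if `t` is adjacent to `s`, where `k` is the
number of `B`-labelled crossings after the (unique) change crossing, and `0` otherwise. -/
noncomputable def incidence (s t : D.EnhancedState) : ℤ :=
  ∑ x : X, if s.AdjacentAt t x then (-1) ^ (s.state.filter fun y => x < y).card else 0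

end EnhancedState

/-- The smallest degree `j` of an enhanced state. -/
noncomputable def jMin : ℤ := sInf (Set.range fun s : D.EnhancedState => s.jDeg)

/-- `jMin` is attained and is a lower bound. -/
theorem isLeast_jMin : IsLeast (Set.range fun s : D.EnhancedState => s.jDeg) D.jMin :=
  ⟨Int.csInf_mem (Set.range_nonempty _) (Set.finite_range _).bddBelow,
    fun _ h => csInf_le (Set.finite_range _).bddBelow h⟩

/-- The cochain module `C^{i,j}(D)`: the free `R`-module on the enhanced states of
bidegree `(i, j)`. -/
abbrev Cochain (R : Type*) [CommRing R] (i j : ℤ) : Type _ :=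
  {s : D.EnhancedState // s.iDeg = i ∧ s.jDeg = j} →₀ R

/-- The linear map `C^{i,j}(D) → C^{i',j}(D)` with `s ↦ ∑ t, (s : t) t`. For `i' = i + 1` this is
the differential `d_i`. -/
noncomputable def differential (R : Type*) [CommRing R] (i i' j : ℤ) :
    D.Cochain R i j →ₗ[R] D.Cochain R i' j :=
  Finsupp.linearCombination R fun s =>
    ∑ t : {t : D.EnhancedState // t.iDeg = i' ∧ t.jDeg = j},
      Finsupp.single t ((s.1.incidence t.1 : ℤ) : R)

/-- The Khovanov cohomology module `H^{i,j}(D) = ker d_i / im d_{i-1}` over `R`. -/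
abbrev KhovanovCohomology (R : Type*) [CommRing R] (i j : ℤ) : Type _ :=
  CohomologyAt (D.differential R (i - 1) i j) (D.differential R i (i + 1) j)

/-- The chord at the crossing `x` of the all-`A` smoothing joins the arc `{0, 1}` to the
arc `{2, 3}`. It is admissible if both ends lie on the same circle. -/
def Admissible (x : X) : Prop := D.circleOf ∅ (x, 0) = D.circleOf ∅ (x, 2)

/-- The pieces into which the circles of the all-`A` smoothing are cut by the two ends of the
chord at `x`: the smoothing arcs at `x` are removed. -/
def CutPiece (x : X) : Type _ :=
  Quot fun d d' : X × Fin 4 => d' = D.glue d ∨ (d.1 ≠ x ∧ d' = smooth ∅ d)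

/-- The piece that contains a given half-edge. -/
def cutPieceOf (x : X) (d : X × Fin 4) : D.CutPiece x := Quot.mk _ d

/-- The chords at `x` and `y` have all their ends on one circle of the all-`A` smoothing, and
there the ends alternate: the ends of each of them separate the ends of the other one. -/
def Alternate (x y : X) : Prop :=
  D.circleOf ∅ (x, 0) = D.circleOf ∅ (y, 0) ∧
    D.cutPieceOf x (y, 0) ≠ D.cutPieceOf x (y, 2) ∧
    D.cutPieceOf y (x, 0) ≠ D.cutPieceOf y (x, 2)

/-- The Lando graph: its vertices are the admissible chords of the all-`A` smoothing, two of them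
being joined by an edge if their ends alternate in the same circle. -/
def landoGraph : SimpleGraph {x : X // D.Admissible x} where
  Adj u v := u ≠ v ∧ D.Alternate u.1 v.1
  symm := ⟨fun _ _ h => ⟨h.1.symm, h.2.1.symm, h.2.2.2, h.2.2.1⟩⟩
  loopless := ⟨fun _ h => h.1 rfl⟩

end

end OrientedLinkDiagram

/-! Each `B`-label adds at most one circle and `τ(s)` is at least minus the number of circles. Hence
`j` is minimal exactly at the all-minus enhancements of the states for which every `B`-label splits
a circle (`EnhancedState.jDeg_eq_jMin_iff`). These extreme states are closed under taking subsets,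
so the row `j = jMin` is the augmented cochain complex of a simplicial complex. Its vertices are the
admissible chords, its edges the pairs that do not alternate (`extremeState_pair_iff`). In degree `1
- n` the cocycles are the functions on the Lando graph that agree on non-adjacent vertices
(`mem_ker_differential_iff`), and the coboundaries are the constants (`mem_range_differential_iff`):
the cohomology measures the failure of the complement graph to be connected.

The Lando graph is bipartite, because alternating chords lie on different sides of their circle
(`dir_ne_of_alternate`). In the complement each part is a clique, so the complement is disconnected
only if both parts are nonempty and completely joined in the Lando graph. It then has two
components, which leaves one copy of `R`.

Planarity enters through Euler's formula: cycles modulo two bound sets of faces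
(`exists_face_potential`). Applied to all edges this gives a checkerboard orientation, by which a
change of label always splits or joins circles (`selfTouching_insert_iff`). Applied to a piece of a
circle it puts alternating chords on different sides. -/

/-! ### Quotients by generated equivalence relations. -/

theorem Quot.rel_of_mk_eq {T : Type*} {r E : T → T → Prop} (hE : Equivalence E)
    (h : ∀ a b, r a b → E a b) {a b : T} (hab : Quot.mk r a = Quot.mk r b) : E a b :=
  hE.eqvGen_iff.1 (Relation.EqvGen.mono h _ _ (Quot.eqvGen_exact hab))

theorem Quot.pred_iff_of_mk_eq {T : Type*} {r : T → T → Prop} {p : T → Prop}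
    (h : ∀ a b, r a b → (p a ↔ p b)) {a b : T} (hab : Quot.mk r a = Quot.mk r b) : p a ↔ p b :=
  Quot.rel_of_mk_eq (E := fun a b => p a ↔ p b)
    ⟨fun _ => Iff.rfl, fun h => h.symm, fun h h' => h.trans h'⟩ h hab

theorem Quot.mk_eq_mk_of_imp {T : Type*} {r s : T → T → Prop}
    (h : ∀ a b, r a b → Quot.mk s a = Quot.mk s b) {a b : T} (hab : Quot.mk r a = Quot.mk r b) :
    Quot.mk s a = Quot.mk s b :=
  Quot.rel_of_mk_eq (E := fun a b => Quot.mk s a = Quot.mk s b)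
    ⟨fun _ => rfl, fun h => h.symm, fun h h' => h.trans h'⟩ h hab

theorem Nat.card_quot_congr {T : Type*} {r s : T → T → Prop}
    (h : ∀ a b, r a b → Quot.mk s a = Quot.mk s b)
    (h' : ∀ a b, s a b → Quot.mk r a = Quot.mk r b) :
    Nat.card (Quot r) = Nat.card (Quot s) :=
  Nat.card_congr
    { toFun := Quot.lift (Quot.mk s) h
      invFun := Quot.lift (Quot.mk r) h'
      left_inv := by rintro ⟨a⟩; rfl
      right_inv := by rintro ⟨a⟩; rfl }

/-- Identifying two distinct classes lowers the number of classes by one. -/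
theorem Nat.card_quot_eq_succ {T : Type*} [Finite T] {r : T → T → Prop} {a b : T}
    (hab : Quot.mk r a ≠ Quot.mk r b) :
    Nat.card (Quot r) = Nat.card (Quot fun d d' => r d d' ∨ (d = a ∧ d' = b)) + 1 := by
  classical
  have hfin : Finite (Quot r) := Finite.of_surjective _ Quot.mk_surjective
  have : Fintype (Quot r) := Fintype.ofFinite _
  -- The class of `b` is sent to that of `a`, so the coarser quotient is the old one without the
  -- class of `b`.
  have e : Quot (fun d d' => r d d' ∨ (d = a ∧ d' = b)) ≃ {c : Quot r // c ≠ Quot.mk r b} :=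
    { toFun := Quot.lift (fun d => if h : Quot.mk r d = Quot.mk r b then ⟨Quot.mk r a, hab⟩
          else ⟨Quot.mk r d, h⟩) (by
        rintro d d' (h | ⟨rfl, rfl⟩)
        · have := Quot.sound h
          simp only [this]
        · simp [hab])
      invFun := fun c => Quot.map (rb := fun d d' => r d d' ∨ (d = a ∧ d' = b)) id
        (fun _ _ h => Or.inl h) c.1
      left_inv := by
        rintro ⟨d⟩
        by_cases h : Quot.mk r d = Quot.mk r b
        · simp only [h, dite_true, Quot.map, id]
          have h1 : Quot.mk (fun d d' => r d d' ∨ (d = a ∧ d' = b)) d = Quot.mk _ b :=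
            congrArg (Quot.map (rb := fun d d' => r d d' ∨ (d = a ∧ d' = b)) id
              (fun _ _ h => Or.inl h)) h
          rw [h1]
          exact Quot.sound (Or.inr ⟨rfl, rfl⟩)
        · simp only [h, dite_false, Quot.map, id]
      right_inv := by
        rintro ⟨⟨d⟩, h⟩
        apply Subtype.ext
        have h : Quot.mk r d ≠ Quot.mk r b := h
        simp [Quot.map, h] }
  rw [Nat.card_congr e, Nat.card_eq_fintype_card, Nat.card_eq_fintype_card,
    Fintype.card_subtype_compl, Fintype.card_subtype_eq]
  have : 0 < Fintype.card (Quot r) := Fintype.card_pos_iff.2 ⟨Quot.mk r a⟩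
  omega

theorem Nat.card_quot_eq_of_mk_eq {T : Type*} {r : T → T → Prop} {a b : T}
    (hab : Quot.mk r a = Quot.mk r b) :
    Nat.card (Quot r) = Nat.card (Quot fun d d' => r d d' ∨ (d = a ∧ d' = b)) :=
  Nat.card_quot_congr (fun _ _ h => Quot.sound (Or.inl h)) (by
    rintro d d' (h | ⟨rfl, rfl⟩)
    exacts [Quot.sound h, hab])

/-! ### Cycles of a permutation composed with a transposition. -/

namespace Equiv.Perm

variable {α : Type*} [Finite α]

/-- An orbit that returns to `a` after `m` steps is exhausted by its first `m` points. -/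
theorem not_sameCycle_of_pow_apply {f : Perm α} {a b : α} {m : ℕ} (hm : 0 < m)
    (ha : (f ^ m) a = a) (hb : ∀ i < m, (f ^ i) a ≠ b) : ¬ f.SameCycle a b := by
  intro h
  obtain ⟨i, hi⟩ := h.exists_nat_pow_eq
  refine hb (i % m) (Nat.mod_lt _ hm) ?_
  rw [← hi]
  conv_rhs => rw [← Nat.mod_add_div i m, pow_add, pow_mul, mul_apply]
  congr 1
  have : ∀ k : ℕ, ((f ^ m) ^ k) a = a := fun k => by
    induction k with
    | zero => rfl
    | succ k ih => rw [pow_succ, mul_apply, ha, ih]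
  exact (this _).symm

/-- Composition with the transposition of two points joins their cycles, or splits the cycle that
contains both. -/
theorem sameCycle_swap_mul_iff [DecidableEq α] (f : Perm α) {a b : α} (hab : a ≠ b) :
    (swap a b * f).SameCycle a b ↔ ¬ f.SameCycle a b := by
  classical
  -- The first time the orbit of `a` under `f` comes back to `{a, b}`. Before it both permutations
  -- move `a` alike; at that time the transposition exchanges a return to `a` with an arrival at
  -- `b`.
  have hex : ∃ k, 0 < k ∧ ((f ^ k) a = a ∨ (f ^ k) a = b) :=
    ⟨orderOf f, orderOf_pos f, Or.inl (by simp [pow_orderOf_eq_one])⟩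
  obtain ⟨hm, hret⟩ := Nat.find_spec hex
  have hmin : ∀ i, 0 < i → i < Nat.find hex → (f ^ i) a ≠ a ∧ (f ^ i) a ≠ b := fun i h0 hi => by
    have := Nat.find_min hex hi
    tauto
  set m := Nat.find hex
  have hpow : ∀ i, i < m → ((swap a b * f) ^ i) a = (f ^ i) a := by
    intro i
    induction i with
    | zero => intro _; rfl
    | succ i ih =>
      intro hi
      obtain ⟨h1, h2⟩ := hmin (i + 1) i.succ_pos hi
      rw [pow_succ', mul_apply, ih (by omega), mul_apply, ← mul_apply f, ← pow_succ',
        swap_apply_of_ne_of_ne h1 h2]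
  have hlast : ((swap a b * f) ^ m) a = swap a b ((f ^ m) a) := by
    obtain ⟨l, hl⟩ : ∃ l, m = l + 1 := ⟨m - 1, by omega⟩
    rw [hl, pow_succ', mul_apply, hpow l (by omega), mul_apply, ← mul_apply f, ← pow_succ']
  have hne : ∀ i < m, (f ^ i) a ≠ b := fun i hi => by
    rcases Nat.eq_zero_or_pos i with rfl | h0
    · exact hab
    · exact (hmin i h0 hi).2
  rcases hret with h | h
  · refine iff_of_true ⟨(m : ℤ), ?_⟩ (not_sameCycle_of_pow_apply hm h hne)
    rw [zpow_natCast, hlast, h, swap_apply_left]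
  · refine iff_of_false (not_sameCycle_of_pow_apply hm ?_ ?_) (not_not.2 ⟨(m : ℤ), ?_⟩)
    · rw [hlast, h, swap_apply_right]
    · intro i hi
      rw [hpow i hi]
      exact hne i hi
    · rw [zpow_natCast, h]

end Equiv.Perm

/-! ### Checkerboard orientations and the effect of a change of label on the circles. -/

namespace OrientedLinkDiagram

section

variable {X : Type*} [Fintype X]

/-- A checkerboard orientation: the half-edges at a crossing are directed alternately towards the
crossing and away from it, and the edges are directed coherently. -/
structure CheckerboardOrientation (D : OrientedLinkDiagram X) where
  dir : X × Fin 4 → ZMod 2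
  dir_rotate : ∀ d, dir (rotateDart d) = dir d + 1
  dir_glue : ∀ d, dir (D.glue d) = dir d + 1

variable {D : OrientedLinkDiagram X} (o : D.CheckerboardOrientation)

theorem CheckerboardOrientation.dir_one (x : X) : o.dir (x, 1) = o.dir (x, 0) + 1 :=
  o.dir_rotate (x, 0)

theorem CheckerboardOrientation.dir_two (x : X) : o.dir (x, 2) = o.dir (x, 0) := by
  have h := o.dir_rotate (x, 1)
  rw [o.dir_one] at h
  exact h.trans (by rw [add_assoc, CharTwo.add_self_eq_zero, add_zero])

theorem CheckerboardOrientation.dir_three (x : X) : o.dir (x, 3) = o.dir (x, 0) + 1 := by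
  have h := o.dir_rotate (x, 2)
  rwa [o.dir_two] at h

/-- Either smoothing joins cyclically neighbouring half-edges, so a checkerboard orientation orients
the circles of every state. -/
theorem CheckerboardOrientation.dir_smoothPartner (b : Bool) (x : X) (k : Fin 4) :
    o.dir (x, smoothPartner b k) = o.dir (x, k) + 1 := by
  have h1 := o.dir_one x
  have h2 := o.dir_two x
  have h3 := o.dir_three x
  have h11 : (1 + 1 : ZMod 2) = 0 := by decide
  fin_cases k <;> cases b <;> simp [smoothPartner, h1, h2, h3, add_assoc, h11]

end

section

variable {X : Type*} [LinearOrder X]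

theorem smoothPartner_smoothPartner (b : Bool) (k : Fin 4) :
    smoothPartner b (smoothPartner b k) = k := by
  revert b k; decide

theorem smooth_smooth (s : Finset X) (d : X × Fin 4) : smooth s (smooth s d) = d :=
  congrArg (Prod.mk d.1) (smoothPartner_smoothPartner _ _)

theorem smooth_of_notMem {s : Finset X} {x : X} (hx : x ∉ s) (k : Fin 4) :
    smooth s (x, k) = (x, smoothPartner false k) := by simp [smooth, hx]

theorem smooth_empty (x : X) (k : Fin 4) : smooth ∅ (x, k) = (x, smoothPartner false k) :=
  smooth_of_notMem (Finset.notMem_empty x) k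

theorem smooth_of_mem {s : Finset X} {x : X} (hx : x ∈ s) (k : Fin 4) :
    smooth s (x, k) = (x, smoothPartner true k) := by simp [smooth, hx]

theorem smooth_insert_of_ne {s : Finset X} {x : X} {d : X × Fin 4} (h : d.1 ≠ x) :
    smooth (insert x s) d = smooth s d := by simp [smooth, h]

end

variable {X : Type*} [Fintype X] [LinearOrder X] (D : OrientedLinkDiagram X)

theorem circleOf_glue (s : Finset X) (d : X × Fin 4) :
    D.circleOf s (D.glue d) = D.circleOf s d :=
  Eq.symm (Quot.sound (Or.inl rfl) : D.circleOf s d = D.circleOf s (D.glue d))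

theorem circleOf_smooth (s : Finset X) (d : X × Fin 4) :
    D.circleOf s (smooth s d) = D.circleOf s d :=
  Eq.symm (Quot.sound (Or.inr rfl) : D.circleOf s d = D.circleOf s (smooth s d))

section

variable {D} (o : D.CheckerboardOrientation)

theorem CheckerboardOrientation.dir_smooth (s : Finset X) (d : X × Fin 4) :
    o.dir (smooth s d) = o.dir d + 1 :=
  o.dir_smoothPartner _ _ _

variable (D) in
/-- The step along a circle of the smoothed diagram, through an edge and a smoothing arc. -/
def walk (s : Finset X) : Equiv.Perm (X × Fin 4) :=
  Function.Involutive.toPerm (smooth s) (smooth_smooth s) *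
    Function.Involutive.toPerm D.glue D.glue_glue

theorem walk_apply (s : Finset X) (d : X × Fin 4) : D.walk s d = smooth s (D.glue d) := rfl

theorem CheckerboardOrientation.dir_walk (s : Finset X) (d : X × Fin 4) :
    o.dir (D.walk s d) = o.dir d := by
  rw [walk_apply, o.dir_smooth, o.dir_glue, add_assoc, CharTwo.add_self_eq_zero, add_zero]

theorem CheckerboardOrientation.dir_eq_of_sameCycle {s : Finset X} {d d' : X × Fin 4}
    (h : (D.walk s).SameCycle d d') : o.dir d = o.dir d' := by
  obtain ⟨i, rfl⟩ := h.exists_nat_pow_eq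
  induction i with
  | zero => rfl
  | succ i ih =>
    rw [pow_succ', Equiv.Perm.mul_apply, o.dir_walk]
    exact ih ⟨i, by simp⟩

/-- The walk is a product of two involutions, so `glue` conjugates it to its inverse. Thus `glue`
exchanges the two directions in which a circle can be walked. -/
theorem sameCycle_walk_glue {s : Finset X} {d d' : X × Fin 4}
    (h : (D.walk s).SameCycle d d') : (D.walk s).SameCycle (D.glue d) (D.glue d') := by
  have h1 := h.conj (g := Function.Involutive.toPerm D.glue D.glue_glue)
  rw [← Equiv.Perm.sameCycle_inv]
  have h2 : (D.walk s)⁻¹ = Function.Involutive.toPerm D.glue D.glue_glue * D.walk s *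
      (Function.Involutive.toPerm D.glue D.glue_glue)⁻¹ := by
    rw [walk, mul_inv_rev, mul_assoc, mul_assoc, mul_inv_cancel, mul_one]
    rfl
  rw [h2]
  exact h1

theorem sameCycle_walk_of_circleOf_eq {s : Finset X} {d d' : X × Fin 4}
    (h : D.circleOf s d = D.circleOf s d') :
    (D.walk s).SameCycle d d' ∨ (D.walk s).SameCycle d (D.glue d') := by
  refine Quot.rel_of_mk_eq
    (E := fun d d' => (D.walk s).SameCycle d d' ∨ (D.walk s).SameCycle d (D.glue d'))
    ⟨fun d => Or.inl (Equiv.Perm.SameCycle.refl _ _), ?_, ?_⟩ ?_ h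
  · rintro d d' (h | h)
    · exact Or.inl h.symm
    · have := sameCycle_walk_glue h
      rw [D.glue_glue] at this
      exact Or.inr this.symm
  · rintro d d' d'' (h | h) (h' | h')
    · exact Or.inl (h.trans h')
    · exact Or.inr (h.trans h')
    · exact Or.inr (h.trans (sameCycle_walk_glue h'))
    · have := sameCycle_walk_glue h'
      rw [D.glue_glue] at this
      exact Or.inl (h.trans this)
  · rintro d d' (rfl | rfl)
    · exact Or.inr (by rw [D.glue_glue])
    · have h1 : (D.walk s).SameCycle (D.glue d) (smooth s d) := ⟨1, by
        rw [zpow_one, walk_apply, D.glue_glue]⟩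
      have := sameCycle_walk_glue h1
      rw [D.glue_glue] at this
      exact Or.inr this

theorem sameCycle_walk_of_sameCycle {s : Finset X} {d d' : X × Fin 4}
    (h : (D.walk s).SameCycle d d') : D.circleOf s d = D.circleOf s d' := by
  obtain ⟨i, rfl⟩ := h.exists_nat_pow_eq
  induction i with
  | zero => rfl
  | succ i ih =>
    rw [pow_succ', Equiv.Perm.mul_apply, walk_apply, circleOf_smooth, circleOf_glue]
    exact ih ⟨i, by simp⟩

variable (D) in
/-- Do the four half-edges at `x` lie on the same circle of the smoothed diagram? -/
def SelfTouching (s : Finset X) (x : X) : Prop := D.circleOf s (x, 0) = D.circleOf s (x, 2)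

theorem circleOf_pair_of_notMem {s : Finset X} {x : X} (hx : x ∉ s) :
    D.circleOf s (x, 1) = D.circleOf s (x, 0) ∧ D.circleOf s (x, 3) = D.circleOf s (x, 2) := by
  have h0 := D.circleOf_smooth s (x, 0)
  have h2 := D.circleOf_smooth s (x, 2)
  rw [smooth_of_notMem hx] at h0 h2
  exact ⟨h0, h2⟩

theorem circleOf_pair_of_mem {s : Finset X} {x : X} (hx : x ∈ s) :
    D.circleOf s (x, 3) = D.circleOf s (x, 0) ∧ D.circleOf s (x, 1) = D.circleOf s (x, 2) := by
  have h0 := D.circleOf_smooth s (x, 0)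
  have h2 := D.circleOf_smooth s (x, 2)
  rw [smooth_of_mem hx] at h0 h2
  exact ⟨h0, h2⟩

/-- The half-edges 1 and 3 have the same checkerboard direction, which the walk preserves and `glue`
reverses. If they share a circle, they are therefore met when walking it in one direction. -/
theorem selfTouching_iff_sameCycle (o : D.CheckerboardOrientation) (s : Finset X) (x : X) :
    D.SelfTouching s x ↔ (D.walk s).SameCycle (x, 1) (x, 3) := by
  have key : D.SelfTouching s x ↔ D.circleOf s (x, 1) = D.circleOf s (x, 3) := by
    by_cases hx : x ∈ s
    · rw [(circleOf_pair_of_mem hx).1, (circleOf_pair_of_mem hx).2, SelfTouching, eq_comm]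
    · rw [(circleOf_pair_of_notMem hx).1, (circleOf_pair_of_notMem hx).2, SelfTouching]
  rw [key]
  refine ⟨fun h => (sameCycle_walk_of_circleOf_eq h).resolve_right fun h => ?_,
    sameCycle_walk_of_sameCycle⟩
  have := o.dir_eq_of_sameCycle h
  rw [o.dir_glue, o.dir_one, o.dir_three] at this
  simp at this

/-- On the half-edges directed like `(x, 1)`, changing the label at `x` composes the walk with the
transposition of `(x, 1)` and `(x, 3)`, which either joins two cycles or splits one. The restriction
to one direction matters: on all half-edges two transpositions would occur. -/
theorem selfTouching_insert_iff (o : D.CheckerboardOrientation) {s : Finset X} {x : X} (hx : x ∉ s) :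
    D.SelfTouching (insert x s) x ↔ ¬ D.SelfTouching s x := by
  rw [selfTouching_iff_sameCycle o, selfTouching_iff_sameCycle o]
  let p : X × Fin 4 → Prop := fun d => o.dir d = o.dir (x, 1)
  have hp : ∀ s d, p (D.walk s d) ↔ p d := fun s d => by simp only [p, o.dir_walk]
  have h13 : o.dir (x, 3) = o.dir (x, 1) := by rw [o.dir_one, o.dir_three]
  let a : Subtype p := ⟨(x, 1), rfl⟩
  let b : Subtype p := ⟨(x, 3), h13⟩
  have hab : a ≠ b := fun h => by simpa [a, b] using congrArg Subtype.val h
  have hmul : (D.walk (insert x s)).subtypePerm (hp _) =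
      Equiv.swap a b * (D.walk s).subtypePerm (hp s) := by
    ext1 ⟨d, hd⟩
    have hd' : o.dir (D.glue d) = o.dir (x, 0) := by
      rw [o.dir_glue, hd, o.dir_one, add_assoc, CharTwo.add_self_eq_zero, add_zero]
    rw [Equiv.Perm.mul_apply]
    by_cases h : (D.glue d).1 = x
    · obtain ⟨k, hk⟩ : ∃ k, D.glue d = (x, k) := ⟨(D.glue d).2, by rw [← h]⟩
      rw [hk] at hd'
      have hk02 : k = 0 ∨ k = 2 := by
        have h1 := o.dir_one x
        have h3 := o.dir_three x
        fin_cases k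
        · exact Or.inl rfl
        · exact absurd (h1.symm.trans hd') (by simp)
        · exact Or.inr rfl
        · exact absurd (h3.symm.trans hd') (by simp)
      rcases hk02 with rfl | rfl
      · have e1 : (D.walk s).subtypePerm (hp s) ⟨d, hd⟩ = a := Subtype.ext (by
          rw [Equiv.Perm.subtypePerm_apply]
          exact (congrArg (smooth s) hk).trans (smooth_of_notMem hx 0))
        rw [e1, Equiv.swap_apply_left]
        refine Subtype.ext ?_
        rw [Equiv.Perm.subtypePerm_apply]
        exact (congrArg (smooth _) hk).trans (smooth_of_mem (Finset.mem_insert_self _ _) 0)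
      · have e1 : (D.walk s).subtypePerm (hp s) ⟨d, hd⟩ = b := Subtype.ext (by
          rw [Equiv.Perm.subtypePerm_apply]
          exact (congrArg (smooth s) hk).trans (smooth_of_notMem hx 2))
        rw [e1, Equiv.swap_apply_right]
        refine Subtype.ext ?_
        rw [Equiv.Perm.subtypePerm_apply]
        exact (congrArg (smooth _) hk).trans (smooth_of_mem (Finset.mem_insert_self _ _) 2)
    · have hne : ∀ c : Subtype p, c.1.1 = x → (D.walk s).subtypePerm (hp s) ⟨d, hd⟩ ≠ c := by
        rintro c hc rfl
        exact h hc
      rw [Equiv.swap_apply_of_ne_of_ne (hne a rfl) (hne b rfl)]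
      refine Subtype.ext ?_
      rw [Equiv.Perm.subtypePerm_apply, Equiv.Perm.subtypePerm_apply]
      exact smooth_insert_of_ne h
  have := Equiv.Perm.sameCycle_swap_mul_iff ((D.walk s).subtypePerm (hp s)) hab
  rwa [← hmul, Equiv.Perm.sameCycle_subtypePerm, Equiv.Perm.sameCycle_subtypePerm] at this

end

section

variable {D}

/-- Joining all half-edges at `x` gives the same classes for both smoothings of `x`. -/
theorem card_dartCircle_join {s : Finset X} {x : X} (hx : x ∉ s) :
    Nat.card (Quot fun d d' : X × Fin 4 => (d' = D.glue d ∨ d' = smooth s d) ∨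
      (d = (x, 0) ∧ d' = (x, 2))) =
    Nat.card (Quot fun d d' : X × Fin 4 => (d' = D.glue d ∨ d' = smooth (insert x s) d) ∨
      (d = (x, 0) ∧ d' = (x, 2))) := by
  have hxi := Finset.mem_insert_self x s
  have key : ∀ (s t : Finset X), (∀ d : X × Fin 4, d.1 ≠ x → smooth t d = smooth s d) →
      ∀ a b : X × Fin 4, ((b = D.glue a ∨ b = smooth s a) ∨ (a = (x, 0) ∧ b = (x, 2))) →
      Quot.mk (fun d d' : X × Fin 4 => (d' = D.glue d ∨ d' = smooth t d) ∨
        (d = (x, 0) ∧ d' = (x, 2))) a = Quot.mk _ b := by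
    intro s t hst a b hab
    rcases hab with (hb | hb) | hb
    · exact Quot.sound (Or.inl (Or.inl hb))
    · by_cases ha : a.1 = x
      · have all : ∀ k, Quot.mk (fun d d' : X × Fin 4 => (d' = D.glue d ∨ d' = smooth t d) ∨
            (d = (x, 0) ∧ d' = (x, 2))) (x, k) = Quot.mk _ (x, 0) := by
          have h02 : Quot.mk (fun d d' : X × Fin 4 => (d' = D.glue d ∨ d' = smooth t d) ∨
            (d = (x, 0) ∧ d' = (x, 2))) (x, 0) = Quot.mk _ (x, 2) :=
            Quot.sound (Or.inr ⟨rfl, rfl⟩)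
          have hs : ∀ k, Quot.mk (fun d d' : X × Fin 4 => (d' = D.glue d ∨ d' = smooth t d) ∨
            (d = (x, 0) ∧ d' = (x, 2))) (x, k) = Quot.mk _ (smooth t (x, k)) :=
            fun k => Quot.sound (Or.inl (Or.inr rfl))
          have hs0 := hs 0
          have hs2 := hs 2
          intro k
          by_cases hxt : x ∈ t
          · rw [smooth_of_mem hxt] at hs0 hs2
            fin_cases k
            exacts [rfl, hs2.symm.trans h02.symm, h02.symm, hs0.symm]
          · rw [smooth_of_notMem hxt] at hs0 hs2
            fin_cases k
            exacts [rfl, hs0.symm, h02.symm, hs2.symm.trans h02.symm]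
        subst ha
        rw [hb]
        exact (all a.2).trans (all _).symm
      · exact Quot.sound (Or.inl (Or.inr (hb.trans (hst a ha).symm)))
    · exact Quot.sound (Or.inr hb)
  exact Nat.card_quot_congr (key _ _ fun d hd => smooth_insert_of_ne hd)
    (key _ _ fun d hd => (smooth_insert_of_ne hd).symm)

/-- Joining all half-edges at `x` leads to the same count from both smoothings. It costs a circle
after the change of label, where `x` is no longer self-touching, and none before. -/
theorem card_dartCircle_insert_of_selfTouching (o : D.CheckerboardOrientation) {s : Finset X}
    {x : X} (hx : x ∉ s) (h : D.SelfTouching s x) :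
    Nat.card (D.DartCircle (insert x s)) = Nat.card (D.DartCircle s) + 1 := by
  have h' : ¬ D.SelfTouching (insert x s) x := by
    rw [selfTouching_insert_iff o hx]; exact not_not.2 h
  exact (Nat.card_quot_eq_succ h').trans
    (congrArg (· + 1) ((card_dartCircle_join hx).symm.trans (Nat.card_quot_eq_of_mk_eq h).symm))

theorem card_dartCircle_insert_of_not_selfTouching (o : D.CheckerboardOrientation) {s : Finset X}
    {x : X} (hx : x ∉ s) (h : ¬ D.SelfTouching s x) :
    Nat.card (D.DartCircle s) = Nat.card (D.DartCircle (insert x s)) + 1 := by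
  have h' := (selfTouching_insert_iff o hx).2 h
  exact (Nat.card_quot_eq_succ h).trans
    (congrArg (· + 1) ((card_dartCircle_join hx).trans (Nat.card_quot_eq_of_mk_eq h').symm))

end

end OrientedLinkDiagram

/-! ### Homology modulo two of a planar diagram. -/

namespace OrientedLinkDiagram

section

variable {X : Type*} [Fintype X] (D : OrientedLinkDiagram X)

/-- The faces of the diagram; the class of a half-edge `d` is the face on the clockwise side
of `d`. -/
abbrev Face : Type _ := Quot fun d d' : X × Fin 4 => d' = rotateDart (D.glue d)

/-- The connected components of the underlying graph. -/
abbrev Component : Type _ := Quot fun d d' : X × Fin 4 => d' = rotateDart d ∨ d' = D.glue d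

/-- The one-chains modulo two: functions on the edges. -/
def edgeChain : Submodule (ZMod 2) (X × Fin 4 → ZMod 2) where
  carrier := {f | ∀ d, f (D.glue d) = f d}
  add_mem' hf hg d := by simp only [Pi.add_apply, hf d, hg d]
  zero_mem' _ := rfl
  smul_mem' c f hf d := by simp only [Pi.smul_apply, hf d]

/-- The boundary of a one-chain. -/
def edgeBoundary : D.edgeChain →ₗ[ZMod 2] X → ZMod 2 where
  toFun f x := ∑ k, f.1 (x, k)
  map_add' f g := by ext x; exact Finset.sum_add_distrib
  map_smul' c f := by ext x; exact (Finset.mul_sum _ _ _).symm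

theorem mk_rotateDart_glue (d : X × Fin 4) :
    (Quot.mk _ (rotateDart (D.glue d)) : D.Face) = Quot.mk _ d :=
  Eq.symm (Quot.sound rfl : (Quot.mk _ d : D.Face) = Quot.mk _ (rotateDart (D.glue d)))

/-- The boundary of a two-chain. -/
def faceBoundary : (D.Face → ZMod 2) →ₗ[ZMod 2] D.edgeChain where
  toFun b := ⟨fun d => b (Quot.mk _ d) + b (Quot.mk _ (rotateDart d)), fun d => by
    dsimp only
    have h := D.mk_rotateDart_glue (D.glue d)
    rw [D.glue_glue] at h
    rw [D.mk_rotateDart_glue, h, add_comm]⟩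
  map_add' b c := by ext d; simp only [Pi.add_apply, Submodule.coe_add]; ring
  map_smul' r b := by ext d; simp [mul_add]

theorem edgeBoundary_faceBoundary (b : D.Face → ZMod 2) :
    D.edgeBoundary (D.faceBoundary b) = 0 := by
  ext x
  have h : ∀ u v w z : ZMod 2, u + v + (v + w) + (w + z) + (z + u) = 0 := by decide
  have h0 := h (b (Quot.mk _ (x, 0))) (b (Quot.mk _ (x, 1))) (b (Quot.mk _ (x, 2)))
    (b (Quot.mk _ (x, 3)))
  change ∑ k : Fin 4, (b (Quot.mk _ (x, k)) + b (Quot.mk _ (x, k + 1))) = 0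
  rw [Fin.sum_univ_four]
  exact h0

/-- A one-chain is determined by its values on the outgoing half-edges, of which every crossing has
two. -/
theorem finrank_edgeChain_le : Module.finrank (ZMod 2) D.edgeChain ≤ 2 * Fintype.card X := by
  let out : X × Bool → X × Fin 4 := fun p =>
    (p.1, if p.2 then 2 else if D.positive p.1 then 1 else 3)
  have hout : ∀ d, isOutgoing (D.positive d.1) d.2 = true → ∃ p, out p = d := by
    rintro ⟨x, k⟩ h
    have : ∀ (b : Bool) (k : Fin 4), isOutgoing b k = true →
        ∃ c : Bool, (if c then 2 else if b then 1 else 3 : Fin 4) = k := by decide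
    obtain ⟨c, hc⟩ := this _ k h
    exact ⟨(x, c), congrArg (Prod.mk x) hc⟩
  let res : D.edgeChain →ₗ[ZMod 2] (X × Bool → ZMod 2) :=
    (LinearMap.funLeft (ZMod 2) (ZMod 2) out).comp D.edgeChain.subtype
  have hres : Function.Injective res := by
    rw [← LinearMap.ker_eq_bot, LinearMap.ker_eq_bot']
    intro f hf
    have hz : ∀ d, isOutgoing (D.positive d.1) d.2 = true → f.1 d = 0 := fun d hd => by
      obtain ⟨p, rfl⟩ := hout d hd
      exact congrFun hf p
    ext d
    cases hd : isOutgoing (D.positive d.1) d.2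
    · exact (f.2 d).symm.trans (hz _ (by rw [D.oriented, hd]; rfl))
    · exact hz d hd
  have := LinearMap.finrank_le_finrank_of_injective hres
  rwa [Module.finrank_fintype_fun_eq_card, Fintype.card_prod, Fintype.card_bool, mul_comm] at this

/-- A function invariant under rotation and `glue` descends to the components. This bounds both the
second homology and the zeroth cohomology. -/
theorem finrank_le_card_component {V : Type*} [AddCommGroup V] [Module (ZMod 2) V]
    (g : V →ₗ[ZMod 2] (X × Fin 4 → ZMod 2)) (hg : Function.Injective g)
    (hr : ∀ v d, g v (rotateDart d) = g v d) (hs : ∀ v d, g v (D.glue d) = g v d) :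
    Module.finrank (ZMod 2) V ≤ Nat.card D.Component := by
  classical
  have hfin : Finite D.Component := Finite.of_surjective _ Quot.mk_surjective
  have : Fintype D.Component := Fintype.ofFinite _
  let l : V →ₗ[ZMod 2] (D.Component → ZMod 2) :=
    { toFun := fun v => Quot.lift (g v) (by
        rintro d d' (rfl | rfl)
        exacts [(hr v d).symm, (hs v d).symm])
      map_add' := fun v w => by ext ⟨d⟩; simp
      map_smul' := fun c v => by ext ⟨d⟩; simp }
  have hl : Function.Injective l := fun v w h => hg (by
    ext d
    exact congrFun h (Quot.mk _ d))
  have := LinearMap.finrank_le_finrank_of_injective hl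
  rwa [Module.finrank_fintype_fun_eq_card, ← Nat.card_eq_fintype_card] at this

theorem finrank_ker_faceBoundary_le :
    Module.finrank (ZMod 2) (LinearMap.ker D.faceBoundary) ≤ Nat.card D.Component := by
  have hrot : ∀ (b : LinearMap.ker D.faceBoundary) (d : X × Fin 4),
      b.1 (Quot.mk _ (rotateDart d)) = b.1 (Quot.mk _ d) := fun b d =>
    (CharTwo.add_eq_zero.1 (congrFun (congrArg Subtype.val (LinearMap.mem_ker.1 b.2)) d)).symm
  refine D.finrank_le_card_component
    ((LinearMap.funLeft (ZMod 2) (ZMod 2) (Quot.mk _)).comp (LinearMap.ker D.faceBoundary).subtype)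
    ?_ hrot ?_
  · intro b c h
    refine Subtype.ext (funext ?_)
    rintro ⟨d⟩
    exact congrFun h d
  · intro b d
    exact (hrot b _).symm.trans (congrArg b.1 (D.mk_rotateDart_glue d))

theorem glue_ne (d : X × Fin 4) : D.glue d ≠ d := fun h => by
  have := D.oriented d
  rw [h] at this
  cases hd : isOutgoing (D.positive d.1) d.2 <;> simp [hd] at this

/-- Evaluated on the boundary of a single edge, a zero-cocycle takes equal values at its two ends.
-/
theorem finrank_ker_dualMap_edgeBoundary_le :
    Module.finrank (ZMod 2) (LinearMap.ker D.edgeBoundary.dualMap) ≤ Nat.card D.Component := by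
  classical
  let g : Module.Dual (ZMod 2) (X → ZMod 2) →ₗ[ZMod 2] (X × Fin 4 → ZMod 2) :=
    LinearMap.pi fun d => LinearMap.applyₗ (Pi.single d.1 1)
  refine D.finrank_le_card_component (g.comp (LinearMap.ker D.edgeBoundary.dualMap).subtype)
    ?_ (fun _ _ => rfl) ?_
  · intro u v h
    refine Subtype.ext (LinearMap.pi_ext' fun x => LinearMap.ext_ring ?_)
    exact congrFun h (x, 0)
  · intro u d
    let e : D.edgeChain := ⟨Pi.single d 1 + Pi.single (D.glue d) 1, fun c => by
      have h1 : D.glue c = d ↔ c = D.glue d :=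
        ⟨fun h => by rw [← h, D.glue_glue], fun h => by rw [h, D.glue_glue]⟩
      have h2 : D.glue c = D.glue d ↔ c = d :=
        ⟨fun h => by rw [← D.glue_glue c, h, D.glue_glue], fun h => by rw [h]⟩
      simp only [Pi.add_apply, Pi.single_apply, h1, h2]
      exact add_comm _ _⟩
    have hsum : ∀ (c : X × Fin 4) (x : X),
        ∑ k, (Pi.single c 1 : X × Fin 4 → ZMod 2) (x, k) = (Pi.single c.1 1 : X → ZMod 2) x := by
      rintro ⟨y, l⟩ x
      by_cases hxy : x = y
      · subst hxy
        simp [Pi.single_apply, Prod.ext_iff]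
      · simp [Prod.ext_iff, hxy]
    have he : D.edgeBoundary e = Pi.single d.1 1 + Pi.single (D.glue d).1 1 := by
      ext x
      rw [Pi.add_apply, ← hsum, ← hsum]
      rw [← Finset.sum_add_distrib]
      rfl
    have h0 : u.1 (D.edgeBoundary e) = 0 :=
      LinearMap.congr_fun (LinearMap.mem_ker.1 u.2) e
    rw [he, map_add] at h0
    exact (CharTwo.add_eq_zero.1 h0).symm

/-- With `V` crossings and `κ` components, the cycles have dimension at most `2V - (V - κ) = V + κ`.
The boundaries have dimension at least `(V + 2κ) - κ`, by the formula for the number of faces. -/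
theorem range_faceBoundary : LinearMap.range D.faceBoundary = LinearMap.ker D.edgeBoundary := by
  classical
  have hfin : Finite D.Face := Finite.of_surjective _ Quot.mk_surjective
  have : Fintype D.Face := Fintype.ofFinite _
  refine Submodule.eq_of_le_of_finrank_le ?_ ?_
  · rintro _ ⟨b, rfl⟩
    exact D.edgeBoundary_faceBoundary b
  · have h1 := D.finrank_edgeChain_le
    have h2 := D.finrank_ker_faceBoundary_le
    have h3 := D.finrank_ker_dualMap_edgeBoundary_le
    have h4 := D.planar
    have h5 := D.edgeBoundary.finrank_range_add_finrank_ker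
    have h6 := D.edgeBoundary.dualMap.finrank_range_add_finrank_ker
    have h7 := D.faceBoundary.finrank_range_add_finrank_ker
    rw [LinearMap.finrank_range_dualMap_eq_finrank_range, Subspace.dual_finrank_eq,
      Module.finrank_fintype_fun_eq_card] at h6
    rw [Module.finrank_fintype_fun_eq_card, ← Nat.card_eq_fintype_card] at h7
    change Nat.card D.Face = _ + 2 * Nat.card D.Component at h4
    omega

/-- In a planar diagram every cycle modulo two is the boundary of a set of faces. -/
theorem exists_face_potential (f : X × Fin 4 → ZMod 2) (hf : ∀ d, f (D.glue d) = f d)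
    (hv : ∀ x, ∑ k, f (x, k) = 0) :
    ∃ b : X × Fin 4 → ZMod 2, (∀ d, b (rotateDart (D.glue d)) = b d) ∧
      ∀ d, f d = b d + b (rotateDart d) := by
  have : (⟨f, hf⟩ : D.edgeChain) ∈ LinearMap.range D.faceBoundary := by
    rw [range_faceBoundary]
    exact funext hv
  obtain ⟨b, hb⟩ := this
  exact ⟨fun d => b (Quot.mk _ d), fun d => congrArg b (D.mk_rotateDart_glue d),
    fun d => (congrFun (congrArg Subtype.val hb) d).symm⟩

/-- Four half-edges meet at each crossing, so the sum of all edges is a cycle. The faces it bounds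
give a checkerboard colouring; the colour on the clockwise side directs a half-edge. -/
theorem nonempty_checkerboardOrientation : Nonempty D.CheckerboardOrientation := by
  obtain ⟨b, hb, hb'⟩ := D.exists_face_potential (fun _ => 1) (fun _ => rfl) (fun _ => by
    rw [Fin.sum_univ_four]; decide)
  have hrot : ∀ d, b (rotateDart d) = b d + 1 := fun d => by
    have : ∀ u v : ZMod 2, 1 = u + v → v = u + 1 := by decide
    exact this _ _ (hb' d)
  refine ⟨⟨b, hrot, fun d => ?_⟩⟩
  have h1 := hb d
  rw [hrot] at h1
  rw [← h1, add_assoc, CharTwo.add_self_eq_zero, add_zero]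

end

end OrientedLinkDiagram

/-! ### Chords of the all-`A` smoothing. -/

namespace OrientedLinkDiagram

variable {X : Type*} [Fintype X] [LinearOrder X] {D : OrientedLinkDiagram X}

theorem cutPieceOf_glue (x : X) (d : X × Fin 4) :
    D.cutPieceOf x (D.glue d) = D.cutPieceOf x d :=
  Eq.symm (Quot.sound (Or.inl rfl) : D.cutPieceOf x d = D.cutPieceOf x (D.glue d))

theorem cutPieceOf_smooth {x : X} {d : X × Fin 4} (h : d.1 ≠ x) :
    D.cutPieceOf x (smooth ∅ d) = D.cutPieceOf x d :=
  Eq.symm (Quot.sound (Or.inr ⟨h, rfl⟩) : D.cutPieceOf x d = D.cutPieceOf x (smooth ∅ d))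

theorem circleOf_insert_eq_of_cutPieceOf_eq {x : X} {d d' : X × Fin 4}
    (h : D.cutPieceOf x d = D.cutPieceOf x d') :
    D.circleOf (insert x ∅) d = D.circleOf (insert x ∅) d' := by
  refine Quot.mk_eq_mk_of_imp ?_ h
  rintro a b (h | h)
  exacts [Quot.sound (Or.inl h), Quot.sound (Or.inr (h.2.trans (smooth_insert_of_ne h.1).symm))]

/-- A set of half-edges closed under the edges and the smoothing arcs away from `x` contains
an even number of the half-edges at `x`. -/
theorem sum_eq_zero_of_invariant {x : X} {p : X × Fin 4 → ZMod 2} (hg : ∀ d, p (D.glue d) = p d)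
    (hs : ∀ d : X × Fin 4, d.1 ≠ x → p (smooth ∅ d) = p d) :
    ∑ k, p (x, k) = 0 := by
  have h1 : ∑ d, p d = 0 := Finset.sum_involution (fun d _ => D.glue d)
    (fun d _ => by rw [hg, CharTwo.add_self_eq_zero]) (fun d _ _ => D.glue_ne d)
    (fun _ _ => Finset.mem_univ _) (fun d _ => D.glue_glue d)
  rw [Fintype.sum_prod_type, Finset.sum_eq_single x] at h1
  · exact h1
  · intro y _ hy
    have h0 := hs (y, 0) hy
    have h2 := hs (y, 2) hy
    rw [smooth_empty] at h0 h2
    change p (y, 1) = _ at h0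
    change p (y, 3) = _ at h2
    rw [Fin.sum_univ_four, h0, h2, CharTwo.add_self_eq_zero, zero_add, CharTwo.add_self_eq_zero]
  · exact fun h => absurd (Finset.mem_univ _) h

open Classical in
/-- The indicator function of the cut piece that contains `e`. -/
noncomputable def pieceIndicator (D : OrientedLinkDiagram X) (x : X) (e d : X × Fin 4) : ZMod 2 :=
  if D.cutPieceOf x d = D.cutPieceOf x e then 1 else 0

theorem pieceIndicator_glue (x : X) (e d : X × Fin 4) :
    D.pieceIndicator x e (D.glue d) = D.pieceIndicator x e d := by
  unfold pieceIndicator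
  rw [cutPieceOf_glue]

theorem pieceIndicator_smooth {x : X} (e : X × Fin 4) {d : X × Fin 4} (h : d.1 ≠ x) :
    D.pieceIndicator x e (smooth ∅ d) = D.pieceIndicator x e d := by
  unfold pieceIndicator
  rw [cutPieceOf_smooth h]

theorem not_selfTouching_of_admissible (o : D.CheckerboardOrientation) {x : X}
    (hx : D.Admissible x) : ¬ D.SelfTouching (insert x ∅) x := by
  rw [selfTouching_insert_iff o (Finset.notMem_empty x)]
  exact not_not.2 hx

/-- By parity no piece contains exactly one or three of the four half-edges at `x`. The
`B`-smoothing splits the circle, which forbids 0 with 2, 0 with 1 and 2 with 3, so only the pairing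
of its own arcs remains. -/
theorem cutPieceOf_ends (o : D.CheckerboardOrientation) {x : X} (hx : D.Admissible x) :
    D.cutPieceOf x (x, 3) = D.cutPieceOf x (x, 0) ∧
      D.cutPieceOf x (x, 1) = D.cutPieceOf x (x, 2) ∧
      D.cutPieceOf x (x, 0) ≠ D.cutPieceOf x (x, 2) := by
  have hns := not_selfTouching_of_admissible o hx
  obtain ⟨h30, h12⟩ := circleOf_pair_of_mem (D := D) (Finset.mem_insert_self x ∅)
  have h02 : D.cutPieceOf x (x, 0) ≠ D.cutPieceOf x (x, 2) := fun h =>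
    hns (circleOf_insert_eq_of_cutPieceOf_eq h)
  have h10 : D.cutPieceOf x (x, 1) ≠ D.cutPieceOf x (x, 0) := fun h =>
    hns ((circleOf_insert_eq_of_cutPieceOf_eq h).symm.trans h12)
  have h32 : D.cutPieceOf x (x, 3) ≠ D.cutPieceOf x (x, 2) := fun h =>
    hns (h30.symm.trans (circleOf_insert_eq_of_cutPieceOf_eq h))
  have key : ∀ e, ∑ k, D.pieceIndicator x e (x, k) = 0 := fun e =>
    sum_eq_zero_of_invariant (pieceIndicator_glue x e) (fun d hd => pieceIndicator_smooth e hd)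
  have k0 := key (x, 0)
  have k2 := key (x, 2)
  rw [Fin.sum_univ_four] at k0 k2
  refine ⟨?_, ?_, h02⟩
  · by_contra h
    simp [pieceIndicator, h10, h02.symm, h] at k0
  · by_contra h
    simp [pieceIndicator, h02, h32, h] at k2

/-- The arcs of the `B`-smoothing at `x` join ends of the same piece, so they merely close up the
pieces. -/
theorem circleOf_insert_eq_iff (o : D.CheckerboardOrientation) {x : X} (hx : D.Admissible x)
    {d d' : X × Fin 4} :
    D.circleOf (insert x ∅) d = D.circleOf (insert x ∅) d' ↔
      D.cutPieceOf x d = D.cutPieceOf x d' := by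
  obtain ⟨h30, h12, -⟩ := cutPieceOf_ends o hx
  refine ⟨fun h => Quot.mk_eq_mk_of_imp ?_ h, circleOf_insert_eq_of_cutPieceOf_eq⟩
  rintro ⟨y, k⟩ b (rfl | rfl)
  · exact (cutPieceOf_glue x _).symm
  · by_cases hy : y = x
    · subst hy
      rw [smooth_of_mem (Finset.mem_insert_self y ∅)]
      fin_cases k
      exacts [h30.symm, h12, h12.symm, h30]
    · rw [smooth_insert_of_ne (d := (y, k)) hy]
      exact (cutPieceOf_smooth (D := D) (d := (y, k)) hy).symm

theorem selfTouching_insert_empty_iff (o : D.CheckerboardOrientation) {x : X}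
    (hx : D.Admissible x) (y : X) :
    D.SelfTouching (insert x ∅) y ↔ D.cutPieceOf x (y, 0) = D.cutPieceOf x (y, 2) :=
  circleOf_insert_eq_iff o hx

theorem circleOf_empty_eq_of_admissible {x : X} (hx : D.Admissible x) (k : Fin 4) :
    D.circleOf ∅ (x, k) = D.circleOf ∅ (x, 0) := by
  obtain ⟨h1, h3⟩ := circleOf_pair_of_notMem (D := D) (Finset.notMem_empty x)
  have h2 : D.circleOf ∅ (x, 2) = D.circleOf ∅ (x, 0) := hx.symm
  fin_cases k
  exacts [rfl, h1, h2, h3.trans h2]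

theorem cutPieceOf_eq_or_eq (o : D.CheckerboardOrientation) {x : X} (hx : D.Admissible x)
    {d : X × Fin 4} (hd : D.circleOf ∅ d = D.circleOf ∅ (x, 0)) :
    D.cutPieceOf x d = D.cutPieceOf x (x, 0) ∨ D.cutPieceOf x d = D.cutPieceOf x (x, 2) := by
  obtain ⟨h30, h12, -⟩ := cutPieceOf_ends o hx
  refine (Quot.pred_iff_of_mk_eq (p := fun d => D.cutPieceOf x d = D.cutPieceOf x (x, 0) ∨
    D.cutPieceOf x d = D.cutPieceOf x (x, 2)) ?_ hd).2 (Or.inl rfl)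
  have hall : ∀ k, D.cutPieceOf x (x, k) = D.cutPieceOf x (x, 0) ∨
      D.cutPieceOf x (x, k) = D.cutPieceOf x (x, 2) := fun k => by
    fin_cases k
    exacts [Or.inl rfl, Or.inr h12, Or.inr rfl, Or.inl h30]
  rintro ⟨y, k⟩ b (rfl | rfl)
  · rw [cutPieceOf_glue]
  · by_cases hy : y = x
    · subst hy
      exact iff_of_true (hall _) (hall _)
    · rw [cutPieceOf_smooth (d := (y, k)) hy]

theorem cutPieceOf_eq_of_circleOf_ne {x : X} (hx : D.Admissible x) {d d' : X × Fin 4}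
    (hd : D.circleOf ∅ d ≠ D.circleOf ∅ (x, 0)) (h : D.circleOf ∅ d = D.circleOf ∅ d') :
    D.cutPieceOf x d = D.cutPieceOf x d' := by
  refine (Quot.rel_of_mk_eq (E := fun d d' => D.circleOf ∅ d = D.circleOf ∅ d' ∧
    (D.circleOf ∅ d ≠ D.circleOf ∅ (x, 0) → D.cutPieceOf x d = D.cutPieceOf x d'))
    ⟨fun d => ⟨rfl, fun _ => rfl⟩, fun h => ⟨h.1.symm, fun h' => (h.2 (h.1 ▸ h')).symm⟩,
      fun h h' => ⟨h.1.trans h'.1, fun h0 => (h.2 h0).trans (h'.2 (h.1 ▸ h0))⟩⟩ ?_ h).2 hd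
  rintro ⟨y, k⟩ b (rfl | rfl)
  · exact ⟨(D.circleOf_glue _ _).symm, fun _ => (cutPieceOf_glue _ _).symm⟩
  · refine ⟨(D.circleOf_smooth _ _).symm, fun h0 => (cutPieceOf_smooth (d := (y, k)) ?_).symm⟩
    rintro rfl
    exact h0 (circleOf_empty_eq_of_admissible hx k)

/-- Changing `x` and `y` in either order ends in the same state, hence with the same number of
circles. -/
theorem selfTouching_insert_comm (o : D.CheckerboardOrientation) {x y : X}
    (hx : D.Admissible x) (hy : D.Admissible y) (hxy : x ≠ y) (h : D.SelfTouching (insert x ∅) y) :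
    D.SelfTouching (insert y ∅) x := by
  by_contra h'
  have h1 := card_dartCircle_insert_of_selfTouching o (Finset.notMem_empty x) hx
  have h2 := card_dartCircle_insert_of_selfTouching o (Finset.notMem_empty y) hy
  have h3 := card_dartCircle_insert_of_selfTouching o (s := insert x ∅) (x := y)
    (by simpa using hxy.symm) h
  have h4 := card_dartCircle_insert_of_not_selfTouching o (s := insert y ∅) (x := x)
    (by simpa using hxy) h'
  rw [Finset.insert_comm] at h4
  omega

/-- After the circle is split at `x`, the chord at `y` has both ends on one circle unless `x`
separates them. A chord on another circle is never separated, and separation is symmetric by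
`selfTouching_insert_comm`. -/
theorem selfTouching_insert_empty_iff_not_alternate (o : D.CheckerboardOrientation) {x y : X}
    (hx : D.Admissible x) (hy : D.Admissible y) (hxy : x ≠ y) :
    D.SelfTouching (insert x ∅) y ↔ ¬ D.Alternate x y := by
  constructor
  · exact fun h h' => h'.2.1 ((selfTouching_insert_empty_iff o hx y).1 h)
  · intro h
    by_contra hs
    refine h ⟨?_, fun h' => hs ((selfTouching_insert_empty_iff o hx y).2 h'), fun h' =>
      hs (selfTouching_insert_comm o hy hx hxy.symm ((selfTouching_insert_empty_iff o hy x).2 h'))⟩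
    by_contra hc
    exact hs ((selfTouching_insert_empty_iff o hx y).2
      (cutPieceOf_eq_of_circleOf_ne hx (Ne.symm hc) hy))

/-- Alternating chords lie on different sides of their circle. -/
theorem dir_ne_of_alternate (o : D.CheckerboardOrientation) {x y : X}
    (hx : D.Admissible x) (hy : D.Admissible y) (hxy : x ≠ y) (h : D.Alternate x y) :
    o.dir (x, 0) ≠ o.dir (y, 0) := by
  obtain ⟨h30, h12, h02⟩ := cutPieceOf_ends o hx
  -- The piece through `(x, 2)`, a closed curve once the `B`-arc at `x` is added, is a cycle modulo
  -- two; `b` below colours the faces on its two sides.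
  set f := D.pieceIndicator x (x, 2) with hf
  have hfx : f (x, 0) = 0 ∧ f (x, 1) = 1 ∧ f (x, 2) = 1 ∧ f (x, 3) = 0 := by
    simp [hf, pieceIndicator, h30, h12, h02]
  have hfy : ∀ z, z ≠ x → f (z, 1) = f (z, 0) ∧ f (z, 3) = f (z, 2) := fun z hz => by
    have h0 := pieceIndicator_smooth (D := D) (x, 2) (d := (z, 0)) hz
    have h2 := pieceIndicator_smooth (D := D) (x, 2) (d := (z, 2)) hz
    rw [smooth_empty] at h0 h2
    exact ⟨h0, h2⟩
  obtain ⟨b, hb, hfb⟩ := D.exists_face_potential f (pieceIndicator_glue x _) (fun z => by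
    rw [Fin.sum_univ_four]
    by_cases hz : z = x
    · subst hz
      rw [hfx.1, hfx.2.1, hfx.2.2.1, hfx.2.2.2]
      decide
    · rw [(hfy z hz).1, (hfy z hz).2, CharTwo.add_self_eq_zero, zero_add,
        CharTwo.add_self_eq_zero])
  have hrot : ∀ z, f (z, 0) = b (z, 0) + b (z, 1) ∧ f (z, 1) = b (z, 1) + b (z, 2) ∧
      f (z, 2) = b (z, 2) + b (z, 3) ∧ f (z, 3) = b (z, 3) + b (z, 0) := fun z =>
    ⟨hfb (z, 0), hfb (z, 1), hfb (z, 2), hfb (z, 3)⟩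
  -- Off the curve this quantity is the colour of the surrounding region. On the curve it is the
  -- colour on the side singled out by the checkerboard orientation. Both are constant along a
  -- piece.
  have hG : ∀ d d', D.cutPieceOf x d = D.cutPieceOf x d' →
      b d + f d * o.dir d = b d' + f d' * o.dir d' := by
    intro d d' hdd
    refine Quot.rel_of_mk_eq (E := fun d d' => b d + f d * o.dir d = b d' + f d' * o.dir d')
      ⟨fun _ => rfl, fun h => h.symm, fun h h' => h.trans h'⟩ ?_ hdd
    rintro ⟨z, k⟩ d' (rfl | ⟨hz, rfl⟩)
    · have e1 := hfb (D.glue (z, k))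
      rw [hb] at e1
      have e2 : f (D.glue (z, k)) = f (z, k) := pieceIndicator_glue x _ _
      rw [e2] at e1 ⊢
      rw [o.dir_glue]
      clear e2
      generalize f (z, k) = u at *
      generalize b (z, k) = v at *
      generalize b (D.glue (z, k)) = w at *
      generalize o.dir (z, k) = t at *
      revert u v w t
      decide
    · have hz : z ≠ x := hz
      obtain ⟨r0, r1, r2, r3⟩ := hrot z
      obtain ⟨s0, s2⟩ := hfy z hz
      have d1 := o.dir_one z
      have d2 := o.dir_two z
      have d3 := o.dir_three z
      have c0 : b (z, 0) + f (z, 0) * o.dir (z, 0) = b (z, 1) + f (z, 1) * o.dir (z, 1) := by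
        rw [s0, d1, r0]
        generalize b (z, 0) = u
        generalize b (z, 1) = v
        generalize o.dir (z, 0) = t
        revert u v t
        decide
      have c2 : b (z, 2) + f (z, 2) * o.dir (z, 2) = b (z, 3) + f (z, 3) * o.dir (z, 3) := by
        rw [s2, d3, d2, r2]
        generalize b (z, 2) = u
        generalize b (z, 3) = v
        generalize o.dir (z, 0) = t
        revert u v t
        decide
      rw [smooth_empty]
      fin_cases k
      exacts [c0, c0.symm, c2, c2.symm]
  obtain ⟨hc, hcut, -⟩ := h
  have hy0 := cutPieceOf_eq_or_eq o hx hc.symm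
  have hy2 := cutPieceOf_eq_or_eq o hx (hy.symm.trans hc.symm)
  obtain ⟨rx0, rx1, rx2, rx3⟩ := hrot x
  obtain ⟨ry0, ry1, ry2, ry3⟩ := hrot y
  obtain ⟨fx0, fx1, fx2, fx3⟩ := hfx
  obtain ⟨fy1, fy3⟩ := hfy y hxy.symm
  have dx2 := o.dir_two x
  have dy2 := o.dir_two y
  have hfe : ∀ d, D.cutPieceOf x d = D.cutPieceOf x (x, 2) → f d = 1 := fun d hd => by
    simp [hf, pieceIndicator, hd]
  have hfn : ∀ d, D.cutPieceOf x d = D.cutPieceOf x (x, 0) → f d = 0 := fun d hd => by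
    simp [hf, pieceIndicator, hd, h02]
  -- The colour at `(x, 2)` differs from that of the other piece, as the half-edge `(x, 1)` of the
  -- curve lies between. At `y` the end on the curve sees the colour of the other piece. The
  -- invariant then forces different directions; `k1` and `k2` are the cases of `(y, 0)` off and on
  -- the curve.
  have k1 : ∀ u v : ZMod 2, 0 = u + v → ∀ w, 1 = v + w → ∀ u' v', 0 = u' + v' → ∀ w', 0 = v' + w' →
      u = u' → ∀ t t', w + t = w' + t' → t ≠ t' := by decide
  have k2 : ∀ u v : ZMod 2, 0 = u + v → ∀ w, 1 = v + w → ∀ u' v', 1 = u' + v' → ∀ w', 1 = v' + w' →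
      u = w' → ∀ t t', w + t = u' + t' → t ≠ t' := by decide
  rw [fx0] at rx0
  rw [fx1] at rx1
  rcases hy0 with hy0 | hy0 <;> rcases hy2 with hy2 | hy2
  · exact absurd (hy0.trans hy2.symm) hcut
  · have g0 := hG _ _ hy0
    have g2 := hG _ _ hy2
    rw [hfn _ hy0, fx0, zero_mul, zero_mul, add_zero, add_zero] at g0
    rw [hfe _ hy2, fx2, one_mul, one_mul, dx2, dy2] at g2
    rw [fy1] at ry1
    rw [hfn _ hy0] at ry0 ry1
    exact k1 _ _ rx0 _ rx1 _ _ ry0 _ ry1 g0.symm _ _ g2.symm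
  · have g0 := hG _ _ hy0
    have g2 := hG _ _ hy2
    rw [hfe _ hy0, fx2, one_mul, one_mul, dx2] at g0
    rw [hfn _ hy2, fx0, zero_mul, zero_mul, add_zero, add_zero] at g2
    rw [fy1] at ry1
    rw [hfe _ hy0] at ry0 ry1
    exact k2 _ _ rx0 _ rx1 _ _ ry0 _ ry1 g2.symm _ _ g0.symm
  · exact absurd (hy0.trans hy2.symm) hcut

end OrientedLinkDiagram

/-! ### The complex in the lowest degree `j`. -/

namespace OrientedLinkDiagram

theorem numPos_add_numNeg {X : Type*} [Fintype X] (D : OrientedLinkDiagram X) :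
    D.numPos + D.numNeg = Fintype.card X := by
  have := Finset.card_filter_add_card_filter_not (s := (Finset.univ : Finset X))
    (fun x => D.positive x = true)
  simpa [numPos, numNeg] using this

variable {X : Type*} [Fintype X] [LinearOrder X] {D : OrientedLinkDiagram X}

theorem card_circle (s : Finset X) :
    Fintype.card (D.Circle s) = Nat.card (D.DartCircle s) + D.freeCircles := by
  rw [← Nat.card_eq_fintype_card]
  exact Nat.card_sum.trans (by rw [Nat.card_eq_fintype_card (α := Fin _), Fintype.card_fin])

theorem card_dartCircle_insert_le (s : Finset X) {x : X} (hx : x ∉ s) :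
    Nat.card (D.DartCircle (insert x s)) ≤ Nat.card (D.DartCircle s) + 1 := by
  obtain ⟨o⟩ := D.nonempty_checkerboardOrientation
  by_cases h : D.SelfTouching s x
  · exact (card_dartCircle_insert_of_selfTouching o hx h).le
  · have := card_dartCircle_insert_of_not_selfTouching o hx h
    omega

theorem card_dartCircle_le (s : Finset X) :
    Nat.card (D.DartCircle s) ≤ Nat.card (D.DartCircle ∅) + s.card := by
  induction s using Finset.induction_on with
  | empty => simp
  | insert x s hx ih =>
    have := card_dartCircle_insert_le (D := D) s hx
    rw [Finset.card_insert_of_notMem hx]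
    omega

variable (D) in
/-- A state is extreme if every change of a label from `A` to `B` that leads to it from the
all-`A` state splits a circle. -/
def ExtremeState (s : Finset X) : Prop :=
  Nat.card (D.DartCircle s) = Nat.card (D.DartCircle ∅) + s.card

theorem extremeState_empty : D.ExtremeState ∅ := by simp [ExtremeState]

/-- A label adds at most one circle, so attaining the maximum leaves no slack at any subset: the
extreme states form a simplicial complex. -/
theorem ExtremeState.of_insert {s : Finset X} {x : X} (hx : x ∉ s)
    (h : D.ExtremeState (insert x s)) : D.ExtremeState s := by
  have h1 := card_dartCircle_insert_le (D := D) s hx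
  have h2 := card_dartCircle_le (D := D) s
  rw [ExtremeState, Finset.card_insert_of_notMem hx] at h
  rw [ExtremeState]
  omega

theorem extremeState_insert_iff {s : Finset X} {x : X} (hx : x ∉ s) (hs : D.ExtremeState s) :
    D.ExtremeState (insert x s) ↔ D.SelfTouching s x := by
  obtain ⟨o⟩ := D.nonempty_checkerboardOrientation
  rw [ExtremeState] at hs
  rw [ExtremeState, Finset.card_insert_of_notMem hx]
  by_cases h : D.SelfTouching s x
  · have := card_dartCircle_insert_of_selfTouching o hx h
    exact iff_of_true (by omega) h
  · have := card_dartCircle_insert_of_not_selfTouching o hx h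
    exact iff_of_false (by omega) h

theorem extremeState_singleton_iff (x : X) : D.ExtremeState {x} ↔ D.Admissible x := by
  rw [← insert_empty_eq]
  exact extremeState_insert_iff (Finset.notMem_empty x) extremeState_empty

/-- The one-skeleton of the complex of extreme states is the complement of the Lando graph. -/
theorem extremeState_pair_iff {x y : X} (hx : D.Admissible x) (hy : D.Admissible y)
    (hxy : x ≠ y) : D.ExtremeState {x, y} ↔ ¬ D.Alternate x y := by
  obtain ⟨o⟩ := D.nonempty_checkerboardOrientation
  rw [Finset.pair_comm, ← selfTouching_insert_empty_iff_not_alternate o hx hy hxy]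
  exact extremeState_insert_iff (by simpa using hxy.symm) ((extremeState_singleton_iff x).2 hx)

theorem EnhancedState.iDeg_eq (s : D.EnhancedState) : s.iDeg = s.state.card - D.numNeg := by
  have h1 := D.numPos_add_numNeg
  have h2 := Finset.card_add_card_compl s.state
  rw [EnhancedState.iDeg, EnhancedState.sigma, writhe]
  omega

theorem EnhancedState.neg_card_le_tau (s : D.EnhancedState) :
    -(Fintype.card (D.Circle s.state) : ℤ) ≤ s.tau := by
  have : ∑ _c : D.Circle s.state, (-1 : ℤ) ≤ s.tau := Finset.sum_le_sum fun c _ => by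
    rcases Int.units_eq_one_or (s.sign c) with h | h <;> simp [h]
  simpa using this

theorem EnhancedState.tau_eq_iff (s : D.EnhancedState) :
    s.tau = -(Fintype.card (D.Circle s.state) : ℤ) ↔ ∀ c, s.sign c = -1 := by
  have h1 : ∑ _c : D.Circle s.state, (-1 : ℤ) = -(Fintype.card (D.Circle s.state) : ℤ) := by simp
  rw [← h1, eq_comm, EnhancedState.tau, Finset.sum_eq_sum_iff_of_le fun c _ => by
    rcases Int.units_eq_one_or (s.sign c) with h | h <;> simp [h]]
  refine ⟨fun h c => Units.ext (h c (Finset.mem_univ c)).symm, fun h c _ => by simp [h c]⟩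

variable (D) in
/-- The enhanced state all of whose signs are negative. -/
def allMinus (s : Finset X) : D.EnhancedState := ⟨s, fun _ => -1⟩

theorem EnhancedState.jDeg_eq (s : D.EnhancedState) :
    s.jDeg = D.writhe + (s.state.card - D.numNeg) + s.tau := by
  rw [EnhancedState.jDeg, s.iDeg_eq]

/-- The number of `B`-labels in `i(s)` compensates for the new circles, at most one per label, that
may lower `τ(s)`. -/
theorem EnhancedState.le_jDeg (s : D.EnhancedState) :
    D.writhe - D.numNeg - (Nat.card (D.DartCircle ∅) + D.freeCircles) ≤ s.jDeg := by
  have h1 := s.neg_card_le_tau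
  have h2 := card_dartCircle_le (D := D) s.state
  rw [card_circle] at h1
  rw [s.jDeg_eq]
  omega

theorem EnhancedState.jDeg_eq_iff (s : D.EnhancedState) :
    s.jDeg = D.writhe - D.numNeg - (Nat.card (D.DartCircle ∅) + D.freeCircles) ↔
      s = D.allMinus s.state ∧ D.ExtremeState s.state := by
  have h1 := s.neg_card_le_tau
  have h2 := card_dartCircle_le (D := D) s.state
  have h3 := s.tau_eq_iff
  have h4 : s = D.allMinus s.state ↔ ∀ c, s.sign c = -1 := by
    obtain ⟨s, e⟩ := s
    simp [allMinus, funext_iff]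
  rw [card_circle] at h1 h3
  rw [h4, ← h3, s.jDeg_eq, ExtremeState]
  omega

theorem jMin_eq :
    D.jMin = D.writhe - D.numNeg - (Nat.card (D.DartCircle ∅) + D.freeCircles) := by
  refine D.isLeast_jMin.unique ⟨⟨D.allMinus ∅, ?_⟩, ?_⟩
  · exact (D.allMinus ∅).jDeg_eq_iff.2 ⟨rfl, extremeState_empty⟩
  · rintro _ ⟨s, rfl⟩
    exact s.le_jDeg

theorem EnhancedState.jDeg_eq_jMin_iff (s : D.EnhancedState) :
    s.jDeg = D.jMin ↔ s = D.allMinus s.state ∧ D.ExtremeState s.state := by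
  rw [jMin_eq, s.jDeg_eq_iff]

theorem adjacentAt_allMinus_iff {s t : Finset X} (hs : D.ExtremeState s) (ht : D.ExtremeState t)
    (x : X) : (D.allMinus s).AdjacentAt (D.allMinus t) x ↔ x ∉ s ∧ t = insert x s := by
  refine ⟨fun h => h.2.1, fun h => ⟨⟨?_, ?_⟩, h, fun _ _ => rfl, fun _ => rfl⟩⟩
  · rw [EnhancedState.iDeg_eq, EnhancedState.iDeg_eq]
    change ((t.card : ℤ) - _) = s.card - _ + 1
    rw [h.2, Finset.card_insert_of_notMem h.1]
    push_cast
    ring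
  · rw [(D.allMinus t).jDeg_eq_jMin_iff.2 ⟨rfl, ht⟩, (D.allMinus s).jDeg_eq_jMin_iff.2 ⟨rfl, hs⟩]

theorem incidence_allMinus_insert {s : Finset X} {x : X} (hx : x ∉ s)
    (h : D.ExtremeState (insert x s)) :
    (D.allMinus s).incidence (D.allMinus (insert x s)) =
      (-1) ^ (s.filter fun y => x < y).card := by
  rw [EnhancedState.incidence, Fintype.sum_eq_single x]
  · rw [if_pos ((adjacentAt_allMinus_iff (h.of_insert hx) h x).2 ⟨hx, rfl⟩)]
    rfl
  · intro z hz
    rw [if_neg]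
    rw [adjacentAt_allMinus_iff (h.of_insert hx) h]
    rintro ⟨h1, h2⟩
    have : z ∈ insert x s := h2 ▸ Finset.mem_insert_self z s
    exact (Finset.mem_insert.1 this).elim hz h1

theorem incidence_eq_zero {s t : D.EnhancedState} (h : ¬ s.state ⊆ t.state) :
    s.incidence t = 0 := by
  rw [EnhancedState.incidence]
  refine Finset.sum_eq_zero fun x _ => if_neg fun hx => h ?_
  rw [hx.2.1.2]
  exact Finset.subset_insert _ _

section

variable (R : Type*) [CommRing R]

theorem differential_apply (i i' j : ℤ) (f : D.Cochain R i j)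
    (t : {t : D.EnhancedState // t.iDeg = i' ∧ t.jDeg = j}) :
    D.differential R i i' j f t = ∑ s, f s * ((s.1.incidence t.1 : ℤ) : R) := by
  rw [differential, Finsupp.linearCombination_apply, Finsupp.sum_fintype _ _ (by simp),
    Finsupp.finsetSum_apply]
  refine Finset.sum_congr rfl fun s _ => ?_
  rw [Finsupp.smul_apply, Finsupp.finsetSum_apply, smul_eq_mul, Finset.sum_eq_single t]
  · rw [Finsupp.single_eq_same]
  · intro u _ hu
    rw [Finsupp.single_eq_of_ne' hu]
  · exact fun h => absurd (Finset.mem_univ _) h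

end

variable (D) in
/-- The basis elements of the extreme complex in the degree of the states with exactly
one `B`-label are the vertices of the Lando graph. -/
noncomputable def vertexState : {x : X // D.Admissible x} ≃
    {s : D.EnhancedState // s.iDeg = 1 - (D.numNeg : ℤ) ∧ s.jDeg = D.jMin} :=
  Equiv.ofBijective (fun u => ⟨D.allMinus {u.1}, by
      rw [EnhancedState.iDeg_eq]; simp [allMinus],
      (EnhancedState.jDeg_eq_jMin_iff _).2 ⟨rfl, (extremeState_singleton_iff u.1).2 u.2⟩⟩) <| by
    constructor
    · intro u v h
      exact Subtype.ext (Finset.singleton_injective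
        (congrArg (fun s => s.1.state) h))
    · rintro ⟨s, hi, hj⟩
      rw [EnhancedState.iDeg_eq] at hi
      obtain ⟨hs, he⟩ := s.jDeg_eq_jMin_iff.1 hj
      obtain ⟨x, hx⟩ := Finset.card_eq_one.1 (show s.state.card = 1 by omega)
      rw [hx] at hs he
      exact ⟨⟨x, (extremeState_singleton_iff x).1 he⟩, Subtype.ext hs.symm⟩

theorem vertexState_coe (u : {x : X // D.Admissible x}) :
    (D.vertexState u).1 = D.allMinus {u.1} := rfl

section

variable (R : Type*) [CommRing R]

/-- The basis elements one degree up are the non-adjacent pairs; for `u < v` the coboundary has the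
coefficient `f u - f v` there, since `v` comes after the change crossing `u`. -/
theorem mem_ker_differential_iff
    (f : D.Cochain R (1 - (D.numNeg : ℤ)) D.jMin) :
    f ∈ LinearMap.ker (D.differential R (1 - (D.numNeg : ℤ)) (1 - (D.numNeg : ℤ) + 1) D.jMin) ↔
      ∀ u v, ¬ D.landoGraph.Adj u v → f (D.vertexState u) = f (D.vertexState v) := by
  have key : ∀ (u v : {x : X // D.Admissible x}) (t : {t : D.EnhancedState //
      t.iDeg = 1 - (D.numNeg : ℤ) + 1 ∧ t.jDeg = D.jMin}), u.1 < v.1 →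
      t.1 = D.allMinus {u.1, v.1} →
      D.differential R (1 - (D.numNeg : ℤ)) (1 - (D.numNeg : ℤ) + 1) D.jMin f t =
        f (D.vertexState u) - f (D.vertexState v) := by
    rintro u v ⟨t, hi, hj⟩ huv rfl
    have hE : D.ExtremeState {u.1, v.1} := ((EnhancedState.jDeg_eq_jMin_iff _).1 hj).2
    have huv' : D.vertexState u ≠ D.vertexState v := fun h =>
      huv.ne (congrArg Subtype.val (D.vertexState.injective h))
    rw [differential_apply, Fintype.sum_eq_add _ _ huv']
    · have h1 : (D.allMinus {v.1}).incidence (D.allMinus {u.1, v.1}) = -1 := by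
        rw [incidence_allMinus_insert (by simpa using huv.ne) hE, Finset.filter_singleton,
          if_pos huv]
        rfl
      have h2 : (D.allMinus {u.1}).incidence (D.allMinus {u.1, v.1}) = 1 := by
        rw [Finset.pair_comm] at hE ⊢
        rw [incidence_allMinus_insert (by simpa using huv.ne') hE, Finset.filter_singleton,
          if_neg huv.not_gt]
        rfl
      rw [vertexState_coe, vertexState_coe, h1, h2]
      push_cast
      ring
    · rintro s ⟨hu, hv⟩
      obtain ⟨w, rfl⟩ := D.vertexState.surjective s
      rw [incidence_eq_zero, Int.cast_zero, mul_zero]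
      intro h
      have h : ({w.1} : Finset X) ⊆ {u.1, v.1} := h
      rw [Finset.singleton_subset_iff, Finset.mem_insert, Finset.mem_singleton] at h
      rcases h with h | h
      exacts [hu (congrArg _ (Subtype.ext h)), hv (congrArg _ (Subtype.ext h))]
  rw [LinearMap.mem_ker]
  constructor
  · intro h
    have aux : ∀ u v : {x : X // D.Admissible x}, u.1 < v.1 → ¬ D.landoGraph.Adj u v →
        f (D.vertexState u) = f (D.vertexState v) := fun u v huv hadj => by
      have hE : D.ExtremeState {u.1, v.1} := (extremeState_pair_iff u.2 v.2 huv.ne).2 fun ha =>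
        hadj ⟨fun h => huv.ne (congrArg _ h), ha⟩
      have := key u v ⟨D.allMinus {u.1, v.1}, by
        rw [EnhancedState.iDeg_eq]
        change (({u.1, v.1} : Finset X).card : ℤ) - _ = _
        rw [Finset.card_pair huv.ne]
        push_cast
        ring, (EnhancedState.jDeg_eq_jMin_iff _).2 ⟨rfl, hE⟩⟩ huv rfl
      rw [h, Finsupp.zero_apply] at this
      exact (sub_eq_zero.1 this.symm)
    intro u v hadj
    rcases lt_trichotomy u.1 v.1 with huv | huv | huv
    · exact aux u v huv hadj
    · rw [Subtype.ext huv]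
    · exact (aux v u huv fun h => hadj h.symm).symm
  · intro h
    ext t
    have hi := t.2.1
    rw [EnhancedState.iDeg_eq] at hi
    obtain ⟨hs, hE⟩ := (EnhancedState.jDeg_eq_jMin_iff _).1 t.2.2
    obtain ⟨x, y, hxy, ht⟩ := Finset.card_eq_two.1 (show t.1.state.card = 2 by omega)
    wlog hlt : x < y generalizing x y
    · exact this y x hxy.symm (ht.trans (Finset.pair_comm _ _))
        (lt_of_le_of_ne (not_lt.1 hlt) hxy.symm)
    rw [ht] at hs hE
    have hy : D.Admissible y := (extremeState_singleton_iff y).1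
      (ExtremeState.of_insert (by simpa using hxy) hE)
    have hx : D.Admissible x := (extremeState_singleton_iff x).1
      (ExtremeState.of_insert (x := y) (by simpa using hxy.symm) (by
        rwa [Finset.pair_comm] at hE))
    rw [key ⟨x, hx⟩ ⟨y, hy⟩ t hlt hs,
      h ⟨x, hx⟩ ⟨y, hy⟩ fun ha => (extremeState_pair_iff hx hy hxy).1 hE ha.2,
      sub_self]
    rfl

/-- One degree down the only basis element is the all-`A`, all-minus state. It has incidence number
one with every vertex. -/
theorem mem_range_differential_iff (f : D.Cochain R (1 - (D.numNeg : ℤ)) D.jMin) :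
    f ∈ LinearMap.range (D.differential R (1 - (D.numNeg : ℤ) - 1) (1 - (D.numNeg : ℤ)) D.jMin) ↔
      ∃ r, ∀ u, f (D.vertexState u) = r := by
  let z : {s : D.EnhancedState // s.iDeg = 1 - (D.numNeg : ℤ) - 1 ∧ s.jDeg = D.jMin} :=
    ⟨D.allMinus ∅, by rw [EnhancedState.iDeg_eq]; simp [allMinus],
      (EnhancedState.jDeg_eq_jMin_iff _).2 ⟨rfl, extremeState_empty⟩⟩
  have hz : ∀ s, s = z := by
    rintro ⟨s, hi, hj⟩
    rw [EnhancedState.iDeg_eq] at hi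
    have hs := (s.jDeg_eq_jMin_iff.1 hj).1
    rw [Finset.card_eq_zero.1 (show s.state.card = 0 by omega)] at hs
    exact Subtype.ext hs
  have key : ∀ (g : D.Cochain R (1 - (D.numNeg : ℤ) - 1) D.jMin) (u : {x : X // D.Admissible x}),
      D.differential R (1 - (D.numNeg : ℤ) - 1) (1 - (D.numNeg : ℤ)) D.jMin g (D.vertexState u) =
        g z := fun g u => by
    rw [differential_apply, Fintype.sum_eq_single z fun s hs => absurd (hz s) hs]
    have : (D.allMinus ∅).incidence (D.allMinus {u.1}) = 1 :=
      incidence_allMinus_insert (Finset.notMem_empty u.1) ((extremeState_singleton_iff u.1).2 u.2)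
    rw [vertexState_coe, this, Int.cast_one, mul_one]
  constructor
  · rintro ⟨g, rfl⟩
    exact ⟨g z, key g⟩
  · rintro ⟨r, hr⟩
    refine ⟨Finsupp.single z r, ?_⟩
    ext s
    obtain ⟨u, rfl⟩ := D.vertexState.surjective s
    rw [key, hr, Finsupp.single_eq_same]

end

/-- The Lando graph is bipartite, the sides of a circle giving the two parts. -/
theorem exists_landoGraph_coloring (D : OrientedLinkDiagram X) :
    ∃ c : {x : X // D.Admissible x} → ZMod 2, ∀ u v, D.landoGraph.Adj u v → c u ≠ c v := by
  obtain ⟨o⟩ := D.nonempty_checkerboardOrientation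
  exact ⟨fun u => o.dir (u.1, 0), fun u v h =>
    dir_ne_of_alternate o u.2 v.2 (fun h' => h.1 (Subtype.ext h')) h.2⟩

end OrientedLinkDiagram

/-! ### Bipartite graphs with disconnected complement. -/

namespace SimpleGraph

/-- A function on the vertices of a bipartite graph that agrees on all pairs of non-adjacent
vertices is constant, unless the graph is complete bipartite. -/
theorem exists_forall_eq_of_not_completeBipartite {V R : Type*} [Finite V] [Nonempty R]
    (G : SimpleGraph V) (c : V → ZMod 2) (hc : ∀ u v, G.Adj u v → c u ≠ c v)
    (hG : ¬ ∃ r s : ℕ, 1 ≤ r ∧ 1 ≤ s ∧ Nonempty (G ≃g completeBipartiteGraph (Fin r) (Fin s)))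
    (f : V → R) (hf : ∀ u v, ¬ G.Adj u v → f u = f v) : ∃ r, ∀ u, f u = r := by
  classical
  have : Fintype V := Fintype.ofFinite V
  -- A colour class is independent, so `f` is constant on it; one non-adjacent pair across the
  -- classes makes the two constants equal.
  have hsame : ∀ u v, c u = c v → f u = f v := fun u v h => hf u v fun h' => hc u v h' h
  have h01 : ∀ a : ZMod 2, a ≠ 0 → a = 1 := by decide
  by_cases h0 : ∃ u, c u = 0
  swap
  · rcases isEmpty_or_nonempty V with hV | ⟨⟨v⟩⟩
    · exact ⟨Classical.arbitrary R, fun u => isEmptyElim u⟩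
    · have h1 : ∀ u, c u = 1 := fun u => h01 _ fun h => h0 ⟨u, h⟩
      exact ⟨f v, fun u => hsame u v ((h1 u).trans (h1 v).symm)⟩
  obtain ⟨u, hu⟩ := h0
  by_cases h1 : ∃ v, c v ≠ 0
  swap
  · push Not at h1
    exact ⟨f u, fun w => hsame w u ((h1 w).trans hu.symm)⟩
  obtain ⟨v, hv⟩ := h1
  by_cases hadj : ∃ u' v', c u' = 0 ∧ c v' ≠ 0 ∧ ¬ G.Adj u' v'
  · obtain ⟨u', v', hu', hv', h⟩ := hadj
    refine ⟨f u', fun w => ?_⟩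
    by_cases hw : c w = 0
    · exact hsame w u' (hw.trans hu'.symm)
    · exact (hsame w v' ((h01 _ hw).trans (h01 _ hv').symm)).trans (hf _ _ h).symm
  · push Not at hadj
    refine absurd ⟨Fintype.card {w // c w = 0}, Fintype.card {w // ¬ c w = 0},
      Fintype.card_pos_iff.2 ⟨⟨u, hu⟩⟩, Fintype.card_pos_iff.2 ⟨⟨v, hv⟩⟩, ⟨?_⟩⟩ hG
    let e : completeBipartiteGraph {w // c w = 0} {w // ¬ c w = 0} ≃g G :=
      { toEquiv := Equiv.sumCompl fun w => c w = 0
        map_rel_iff' := by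
          rintro (⟨a, ha⟩ | ⟨a, ha⟩) (⟨b, hb⟩ | ⟨b, hb⟩)
          · simpa using fun h => hc a b h (ha.trans hb.symm)
          · simpa using hadj a b ha hb
          · simpa using (hadj b a hb ha).symm
          · simpa using fun h => hc a b h ((h01 _ ha).trans (h01 _ hb).symm) }
    let e' : completeBipartiteGraph {w // c w = 0} {w // ¬ c w = 0} ≃g
        completeBipartiteGraph (Fin (Fintype.card {w // c w = 0}))
          (Fin (Fintype.card {w // ¬ c w = 0})) :=
      { toEquiv := Equiv.sumCongr (Fintype.equivFin _) (Fintype.equivFin _)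
        map_rel_iff' := by rintro (a | a) (b | b) <;> simp }
    exact e.symm.trans e'

end SimpleGraph

/-! ### The cohomology module. -/

theorem corollary4p5 (R : Type*) [CommRing R] {X : Type*} [Fintype X] [LinearOrder X]
    (D : OrientedLinkDiagram X) :
    ((∃ r s : ℕ, 1 ≤ r ∧ 1 ≤ s ∧
        Nonempty (D.landoGraph ≃g completeBipartiteGraph (Fin r) (Fin s))) →
      Nonempty (D.KhovanovCohomology R (1 - (D.numNeg : ℤ)) D.jMin ≃ₗ[R] R)) ∧
    ((¬ ∃ r s : ℕ, 1 ≤ r ∧ 1 ≤ s ∧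
        Nonempty (D.landoGraph ≃g completeBipartiteGraph (Fin r) (Fin s))) →
      Subsingleton (D.KhovanovCohomology R (1 - (D.numNeg : ℤ)) D.jMin)) := by
  constructor
  · rintro ⟨r, s, hr, hs, ⟨e⟩⟩
    let a : Fin r ⊕ Fin s := Sum.inl ⟨0, hr⟩
    let b : Fin r ⊕ Fin s := Sum.inr ⟨0, hs⟩
    let ev : Fin r ⊕ Fin s → D.Cochain R (1 - (D.numNeg : ℤ)) D.jMin →ₗ[R] R := fun p =>
      Finsupp.lapply (D.vertexState (e.symm p))
    let K := LinearMap.ker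
      (D.differential R (1 - (D.numNeg : ℤ)) (1 - (D.numNeg : ℤ) + 1) D.jMin)
    -- A cocycle consists of one constant for each part; their difference is arbitrary and vanishes
    -- exactly on the coboundaries.
    let l : K →ₗ[R] R := (ev a - ev b).comp K.subtype
    have hconst : ∀ f ∈ K, ∀ p q, (p.isLeft = q.isLeft) → ev p f = ev q f := by
      intro f hf p q hpq
      refine (OrientedLinkDiagram.mem_ker_differential_iff R f).1 hf _ _ ?_
      rw [e.symm.map_adj_iff]
      rcases p with p | p <;> rcases q with q | q <;> simp at hpq ⊢
    have hsurj : Function.Surjective l := by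
      intro r
      let f : D.Cochain R (1 - (D.numNeg : ℤ)) D.jMin := Finsupp.equivFunOnFinite.symm fun s =>
        if (e (D.vertexState.symm s)).isLeft then r else 0
      have hfu : ∀ u, f (D.vertexState u) = if (e u).isLeft then r else 0 := fun u => by
        simp [f]
      have hf : f ∈ K := by
        refine (OrientedLinkDiagram.mem_ker_differential_iff R f).2 fun u v huv => ?_
        rw [← e.map_adj_iff] at huv
        rw [hfu, hfu]
        rcases hp : e u with p | p <;> rcases hq : e v with q | q <;> simp [hp, hq] at huv ⊢
      refine ⟨⟨f, hf⟩, ?_⟩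
      change f (D.vertexState (e.symm a)) - f (D.vertexState (e.symm b)) = r
      rw [hfu, hfu]
      simp [a, b]
    have hker : LinearMap.ker l = (LinearMap.range (D.differential R (1 - (D.numNeg : ℤ) - 1)
        (1 - (D.numNeg : ℤ)) D.jMin)).submoduleOf K := by
      ext ⟨f, hf⟩
      rw [LinearMap.mem_ker, Submodule.submoduleOf, Submodule.mem_comap,
        OrientedLinkDiagram.mem_range_differential_iff]
      change ev a f - ev b f = 0 ↔ _
      rw [sub_eq_zero]
      constructor
      · intro h
        have hu : ∀ u, f (D.vertexState u) = ev (e u) f := fun u => by simp [ev]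
        refine ⟨ev a f, fun u => (hu u).trans ?_⟩
        rcases hp : e u with p | p
        · exact hconst f hf _ _ rfl
        · exact (hconst f hf (Sum.inr p) b rfl).trans h.symm
      · rintro ⟨r, hr⟩
        exact (hr _).trans (hr _).symm
    exact ⟨(Submodule.quotEquivOfEq _ _ hker.symm).trans (l.quotKerEquivOfSurjective hsurj)⟩
  · intro hG
    obtain ⟨c, hc⟩ := D.exists_landoGraph_coloring
    refine Submodule.Quotient.subsingleton_iff.2 (Submodule.submoduleOf_eq_top.2 ?_)
    intro f hf
    rw [OrientedLinkDiagram.mem_range_differential_iff]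
    exact D.landoGraph.exists_forall_eq_of_not_completeBipartite c hc hG _
      ((OrientedLinkDiagram.mem_ker_differential_iff R f).1 hf)
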